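/- Let $d\ge 1$ and $\mathcal D=\{1,\dots,d\}$. For each $j\in\mathcal D$ let $\rho_j:\mathbb R\to(0,\infty)$ be a strictly positive probability density with distribution function $\Phi_j(x)=\int_{-\infty}^x\rho_j(t)\,dt$, and let $\psi_j:\mathbb R\to(0,\infty)$ be locally integrable with $1/\psi_j$ locally integrable. Let $\gamma_{\mathfrak u}>0$ for every $\mathfrak u\subseteq\mathcal D$. Write $\psi_{\mathfrak u}(x_{\mathfrak u})=\prod_{j\in\mathfrak u}\psi_j(x_j)$ and $\rho_{\mathcal D\setminus\mathfrak u}(x_{\mathcal D\setminus\mathfrak u})=\prod_{j\in\mathcal D\setminus\mathfrak u}\rho_j(x_j)$. Let $\mathcal W_d$ be the space of locally integrable functions $f:\mathbb R^d\to\mathbb R$, modulo equality almost everywhere, such that for every $\mathfrak u\subseteq\mathcal D$ the weak derivative $\partial^{\mathfrak u}f=\prod_{j\in\mathfrak u}\frac{\partial}{\partial x_j}f$ exists as a locally integrable function, the integral $$(P_{\mathfrak u}f)(x_{\mathfrak u})=\int_{\mathbb R^{d-|\mathfrak u|}}\partial^{\mathfrak u}f(x_{\mathfrak u},x_{\mathcal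 D\setminus\mathfrak u})\,\rho_{\mathcal D\setminus\mathfrak u}(x_{\mathcal D\setminus\mathfrak u})\,dx_{\mathcal D\setminus\mathfrak u}$$ exists for almost every $x_{\mathfrak u}\in\mathbb R^{|\mathfrak u|}$, and $\int_{\mathbb R^{|\mathfrak u|}}|P_{\mathfrak u}f|^2\,\psi_{\mathfrak u}\,dx_{\mathfrak u}<\infty$. Put $$\langle f,g\rangle_{\mathcal W_d}=\sum_{\mathfrak u\subseteq\mathcal D}\frac1{\gamma_{\mathfrak u}}\int_{\mathbb R^{|\mathfrak u|}}(P_{\mathfrak u}f)(x_{\mathfrak u})\,(P_{\mathfrak u}g)(x_{\mathfrak u})\,\psi_{\mathfrak u}(x_{\mathfrak u})\,dx_{\mathfrak u}.$$ Suppose that for every $j\in\mathcal D$ and every $c\in\mathbb R$ $$\int_{-\infty}^c\frac{\Phi_j(t)^2}{\psi_j(t)}\,dt<\infty\quad\text{and}\quad\int_c^\infty\frac{(1-\Phi_j(t))^2}{\psi_j(t)}\,dt<\infty .$$ Then $\langle\cdot,\cdot\rangle_{\mathcal W_d}$ is an inner product on $\mathcal W_d$ for which $\mathcal W_d$ is a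 Hilbert space, every $f\in\mathcal W_d$ has a continuous representative, and, with point values taken from these continuous representatives, $\mathcal W_d$ is a reproducing kernel Hilbert space of functions on $\mathbb R^d$ with kernel $$K_d(x,y)=\sum_{\mathfrak u\subseteq\mathcal D}\gamma_{\mathfrak u}\prod_{j\in\mathfrak u}\eta_j(x_j,y_j),$$ where $$\eta_j(x,y)=\int_{-\infty}^{\min(x,y)}\frac{\Phi_j(t)^2}{\psi_j(t)}\,dt+\int_{\max(x,y)}^{\infty}\frac{(1-\Phi_j(t))^2}{\psi_j(t)}\,dt-\int_{\min(x,y)}^{\max(x,y)}\frac{\Phi_j(t)(1-\Phi_j(t))}{\psi_j(t)}\,dt .$$ That is, $K_d(\cdot,y)\in\mathcal W_d$ and $f(y)=\langle f,K_d(\cdot,y)\rangle_{\mathcal W_d}$ for all $f\in\mathcal W_d$ and all $y\in\mathbb R^d$. -/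

import Mathlib

open MeasureTheory Set
open scoped ContDiff

noncomputable section

namespace Anova

variable {d : ℕ}

/-- Iterated partial derivative along the coordinates in a list:
`[j₁, …, jₘ]` gives `∂/∂x_{j₁} ⋯ ∂/∂x_{jₘ} v`. -/
def listDeriv : List (Fin d) → ((Fin d → ℝ) → ℝ) → (Fin d → ℝ) → ℝ
  | [], v => v
  | j :: l, v => fun x => fderiv ℝ (listDeriv l v) x (Pi.single j 1)

/-- The classical first-order mixed partial derivative `∂^u v = ∏_{j ∈ u} ∂/∂x_j v`
of a smooth function `v`. -/
def mixedDeriv (u : Finset (Fin d)) (v : (Fin d → ℝ) → ℝ) : (Fin d → ℝ) → ℝ :=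
  listDeriv (u.sort (· ≤ ·)) v

/-- `g` is a weak mixed first-order derivative `∂^u f`. -/
structure HasWeakDeriv (u : Finset (Fin d)) (f g : (Fin d → ℝ) → ℝ) : Prop where
  locInt : LocallyIntegrable f volume
  locInt_deriv : LocallyIntegrable g volume
  integral_eq : ∀ v : (Fin d → ℝ) → ℝ, ContDiff ℝ ∞ v → HasCompactSupport v →
    ∫ x, g x * v x = (-1) ^ u.card * ∫ x, f x * mixedDeriv u v x

open Classical in
/-- The weak derivative `∂^u f` (unique up to null sets whenever it exists; `0` otherwise). -/
def weakDeriv (u : Finset (Fin d)) (f : (Fin d → ℝ) → ℝ) : (Fin d → ℝ) → ℝ :=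
  if h : ∃ g, HasWeakDeriv u f g then h.choose else 0

/-- The point of `ℝ^d` with coordinates `x_u` in `u` and `z` outside `u`. -/
def glue (u : Finset (Fin d)) (xu : {j // j ∈ u} → ℝ) (z : {j // j ∉ u} → ℝ) : Fin d → ℝ :=
  fun j => if h : j ∈ u then xu ⟨j, h⟩ else z ⟨j, h⟩

/-- The product of the densities `ρ_j` over the inactive variables `j ∉ u`. -/
def rhoCompl (ρ : Fin d → ℝ → ℝ) (u : Finset (Fin d)) (z : {j // j ∉ u} → ℝ) : ℝ :=
  ∏ j, ρ j.1 (z j)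

/-- The product of the weights `ψ_j` over the active variables `j ∈ u`. -/
def psiProd (ψ : Fin d → ℝ → ℝ) (u : Finset (Fin d)) (xu : {j // j ∈ u} → ℝ) : ℝ :=
  ∏ j, ψ j.1 (xu j)

/-- The inner integral `∫ g(x_u, z) ρ_{D∖u}(z) dz` over the inactive variables. -/
def innerInt (ρ : Fin d → ℝ → ℝ) (u : Finset (Fin d)) (g : (Fin d → ℝ) → ℝ)
    (xu : {j // j ∈ u} → ℝ) : ℝ :=
  ∫ z, g (glue u xu z) * rhoCompl ρ u z

/-- `f` is locally integrable, has all weak mixed first-order derivatives `∂^u f`, and its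
ANOVA norm is finite: for every `u`, the inner integral of `∂^u f` exists for almost every `x_u`
and is square integrable with weight `ψ_u`. -/
def MemAnova (ρ ψ : Fin d → ℝ → ℝ) (f : (Fin d → ℝ) → ℝ) : Prop :=
  LocallyIntegrable f volume ∧ ∀ u : Finset (Fin d), ∃ g, HasWeakDeriv u f g ∧
    (∀ᵐ xu, Integrable (fun z => g (glue u xu z) * rhoCompl ρ u z)) ∧
    Integrable (fun xu => (innerInt ρ u g xu) ^ 2 * psiProd ψ u xu)

/-- The unanchored ANOVA inner product. -/
def anovaInner (ρ ψ : Fin d → ℝ → ℝ) (γ : Finset (Fin d) → ℝ) (f g : (Fin d → ℝ) → ℝ) : ℝ :=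
  ∑ u : Finset (Fin d), 1 / γ u *
    ∫ xu, innerInt ρ u (weakDeriv u f) xu * innerInt ρ u (weakDeriv u g) xu * psiProd ψ u xu

/-- The distribution function of a density. -/
def distFun (r : ℝ → ℝ) (x : ℝ) : ℝ := ∫ t in Iic x, r t

/-- The integrability condition on a pair `(r, p)` of a density and a derivative weight. -/
def WeakerCondition (r p : ℝ → ℝ) : Prop :=
  ∀ c : ℝ, IntegrableOn (fun t => (distFun r t) ^ 2 / p t) (Iic c) ∧
    IntegrableOn (fun t => (1 - distFun r t) ^ 2 / p t) (Ici c)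

/-- The univariate kernel `η`. -/
def eta (r p : ℝ → ℝ) (x y : ℝ) : ℝ :=
  (∫ t in Iic (min x y), (distFun r t) ^ 2 / p t)
    + (∫ t in Ici (max x y), (1 - distFun r t) ^ 2 / p t)
    - ∫ t in (min x y)..(max x y), distFun r t * (1 - distFun r t) / p t

/-- The `d`-variate kernel `K_d`. -/
def anovaKernel (ρ ψ : Fin d → ℝ → ℝ) (γ : Finset (Fin d) → ℝ) (x y : Fin d → ℝ) : ℝ :=
  ∑ u : Finset (Fin d), γ u * ∏ j ∈ u, eta (ρ j) (ψ j) (x j) (y j)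

/-! Helper facts: membership in the ANOVA space is stable under the vector space operations
and under changes on null sets. -/

theorem listDeriv_smooth (l : List (Fin d)) {v : (Fin d → ℝ) → ℝ} (hv : ContDiff ℝ ∞ v)
    (hc : HasCompactSupport v) :
    ContDiff ℝ ∞ (listDeriv l v) ∧ HasCompactSupport (listDeriv l v) := by
  induction l with
  | nil => exact ⟨hv, hc⟩
  | cons j l ih =>
    refine ⟨(ih.1.fderiv_right (m := ∞) (by simp)).clm_apply contDiff_const, ?_⟩
    exact ih.2.fderiv_apply (𝕜 := ℝ) _

theorem integrable_mul_test {f v : (Fin d → ℝ) → ℝ} (hf : LocallyIntegrable f volume)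
    (hv : Continuous v) (hc : HasCompactSupport v) : Integrable (fun x => f x * v x) := by
  simpa [mul_comm] using hf.integrable_smul_left_of_hasCompactSupport hv hc

theorem HasWeakDeriv.congr {u : Finset (Fin d)} {f f' g : (Fin d → ℝ) → ℝ}
    (h : HasWeakDeriv u f g) (hff : f =ᵐ[volume] f') : HasWeakDeriv u f' g where
  locInt := h.locInt.congr hff
  locInt_deriv := h.locInt_deriv
  integral_eq v hv hc := by
    rw [h.integral_eq v hv hc]
    congr 1
    refine integral_congr_ae ?_
    filter_upwards [hff] with x hx
    rw [hx]

theorem HasWeakDeriv.add {u : Finset (Fin d)} {f₁ f₂ g₁ g₂ : (Fin d → ℝ) → ℝ}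
    (h₁ : HasWeakDeriv u f₁ g₁) (h₂ : HasWeakDeriv u f₂ g₂) :
    HasWeakDeriv u (f₁ + f₂) (g₁ + g₂) where
  locInt := h₁.locInt.add h₂.locInt
  locInt_deriv := h₁.locInt_deriv.add h₂.locInt_deriv
  integral_eq v hv hc := by
    have hD : ContDiff ℝ ∞ (mixedDeriv u v) ∧ HasCompactSupport (mixedDeriv u v) :=
      listDeriv_smooth _ hv hc
    simp only [Pi.add_apply, add_mul]
    rw [integral_add (integrable_mul_test h₁.locInt_deriv hv.continuous hc)
        (integrable_mul_test h₂.locInt_deriv hv.continuous hc),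
      integral_add (integrable_mul_test h₁.locInt hD.1.continuous hD.2)
        (integrable_mul_test h₂.locInt hD.1.continuous hD.2),
      h₁.integral_eq v hv hc, h₂.integral_eq v hv hc, mul_add]

theorem HasWeakDeriv.smul {u : Finset (Fin d)} {f g : (Fin d → ℝ) → ℝ} (c : ℝ)
    (h : HasWeakDeriv u f g) : HasWeakDeriv u (c • f) (c • g) where
  locInt := h.locInt.smul c
  locInt_deriv := h.locInt_deriv.smul c
  integral_eq v hv hc := by
    simp only [Pi.smul_apply, smul_eq_mul, mul_assoc]
    rw [integral_const_mul, integral_const_mul, h.integral_eq v hv hc]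
    ring

theorem measurePreserving_glue (u : Finset (Fin d)) :
    MeasurePreserving (fun p : ({j // j ∈ u} → ℝ) × ({j // j ∉ u} → ℝ) => glue u p.1 p.2)
      (volume.prod volume) volume := by
  have h := (volume_preserving_piEquivPiSubtypeProd (fun _ : Fin d => ℝ) (fun j => j ∈ u)).symm
  have he : (fun p : ({j // j ∈ u} → ℝ) × ({j // j ∉ u} → ℝ) => glue u p.1 p.2) =
      (MeasurableEquiv.piEquivPiSubtypeProd (fun _ : Fin d => ℝ) (fun j => j ∈ u)).symm := by
    funext p j
    by_cases hj : j ∈ u <;>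
      simp [glue, hj, MeasurableEquiv.piEquivPiSubtypeProd, Equiv.piEquivPiSubtypeProd]
  rw [he]
  rw [← Measure.volume_eq_prod]
  convert h
  rfl

theorem aestronglyMeasurable_innerInt {ρ : Fin d → ℝ → ℝ}
    (hρ : ∀ j, AEStronglyMeasurable (ρ j) volume) (u : Finset (Fin d)) {g : (Fin d → ℝ) → ℝ}
    (hg : AEStronglyMeasurable g volume) : AEStronglyMeasurable (innerInt ρ u g) volume := by
  have h1 := hg.comp_measurePreserving (measurePreserving_glue u)
  have h2 : AEStronglyMeasurable (rhoCompl ρ u) volume := by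
    unfold rhoCompl
    refine Finset.aestronglyMeasurable_fun_prod _ fun j _ => ?_
    exact (hρ j.1).comp_quasiMeasurePreserving
      (Measure.quasiMeasurePreserving_eval (fun _ : {j // j ∉ u} => (volume : Measure ℝ)) j)
  exact (h1.mul h2.comp_snd).integral_prod_right'

theorem aestronglyMeasurable_psiProd {ψ : Fin d → ℝ → ℝ}
    (hψ : ∀ j, AEStronglyMeasurable (ψ j) volume) (u : Finset (Fin d)) :
    AEStronglyMeasurable (psiProd ψ u) volume := by
  unfold psiProd
  refine Finset.aestronglyMeasurable_fun_prod _ fun j _ => ?_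
  exact (hψ j.1).comp_quasiMeasurePreserving
    (Measure.quasiMeasurePreserving_eval (fun _ : {j // j ∈ u} => (volume : Measure ℝ)) j)

theorem MemAnova.congr {ρ ψ : Fin d → ℝ → ℝ} {f f' : (Fin d → ℝ) → ℝ}
    (h : MemAnova ρ ψ f) (hff : f =ᵐ[volume] f') : MemAnova ρ ψ f' :=
  ⟨h.1.congr hff, fun u => let ⟨g, hg, hi⟩ := h.2 u; ⟨g, hg.congr hff, hi⟩⟩

theorem MemAnova.zero (ρ ψ : Fin d → ℝ → ℝ) : MemAnova ρ ψ 0 := by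
  have h0 : LocallyIntegrable (0 : (Fin d → ℝ) → ℝ) volume := locallyIntegrable_zero
  refine ⟨h0, fun u => ⟨0, ⟨h0, h0, by simp⟩, by simp, by simp [innerInt]⟩⟩

theorem MemAnova.smul {ρ ψ : Fin d → ℝ → ℝ} {f : (Fin d → ℝ) → ℝ} (c : ℝ)
    (h : MemAnova ρ ψ f) : MemAnova ρ ψ (c • f) := by
  refine ⟨h.1.smul c, fun u => ?_⟩
  obtain ⟨g, hg, hi, hn⟩ := h.2 u
  refine ⟨c • g, hg.smul c, ?_, ?_⟩
  · filter_upwards [hi] with xu hx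
    simpa [mul_assoc] using hx.const_mul c
  · refine (hn.const_mul (c ^ 2)).congr (.of_forall fun xu => ?_)
    simp only [innerInt, Pi.smul_apply, smul_eq_mul, mul_assoc, integral_const_mul]
    ring

theorem MemAnova.add {ρ ψ : Fin d → ℝ → ℝ} (hρ : ∀ j, Integrable (ρ j) volume)
    (hψ : ∀ j, LocallyIntegrable (ψ j) volume) {f₁ f₂ : (Fin d → ℝ) → ℝ}
    (h₁ : MemAnova ρ ψ f₁) (h₂ : MemAnova ρ ψ f₂) : MemAnova ρ ψ (f₁ + f₂) := by
  refine ⟨h₁.1.add h₂.1, fun u => ?_⟩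
  obtain ⟨g₁, hg₁, hi₁, hn₁⟩ := h₁.2 u
  obtain ⟨g₂, hg₂, hi₂, hn₂⟩ := h₂.2 u
  refine ⟨g₁ + g₂, hg₁.add hg₂, ?_, ?_⟩
  · filter_upwards [hi₁, hi₂] with xu hx₁ hx₂
    simp only [Pi.add_apply, add_mul]
    exact hx₁.add hx₂
  · have hm : ∀ j, AEStronglyMeasurable (ρ j) volume := fun j => (hρ j).aestronglyMeasurable
    have hsum := hg₁.locInt_deriv.add hg₂.locInt_deriv
    refine ((hn₁.norm.const_mul 2).add (hn₂.norm.const_mul 2)).mono'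
      (((aestronglyMeasurable_innerInt hm u hsum.aestronglyMeasurable).pow 2).mul
        (aestronglyMeasurable_psiProd (fun j => (hψ j).aestronglyMeasurable) u)) ?_
    filter_upwards [hi₁, hi₂] with xu hx₁ hx₂
    have he : innerInt ρ u (g₁ + g₂) xu = innerInt ρ u g₁ xu + innerInt ρ u g₂ xu := by
      simp only [innerInt, Pi.add_apply, add_mul]
      exact integral_add hx₁ hx₂
    simp only [Pi.add_apply, norm_mul, norm_pow, Real.norm_eq_abs,
      sq_abs, he]
    nlinarith [mul_nonneg (sq_nonneg (innerInt ρ u g₁ xu - innerInt ρ u g₂ xu))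
      (abs_nonneg (psiProd ψ u xu))]

/-- The unanchored ANOVA space `W_d`, as a space of functions modulo equality almost
everywhere. -/
def anovaSpace (ρ ψ : Fin d → ℝ → ℝ) (hρ : ∀ j, Integrable (ρ j) volume)
    (hψ : ∀ j, LocallyIntegrable (ψ j) volume) :
    Submodule ℝ ((Fin d → ℝ) →ₘ[(volume : Measure (Fin d → ℝ))] ℝ) where
  carrier := {f | MemAnova ρ ψ f}
  add_mem' {f g} hf hg :=
    (MemAnova.add hρ hψ hf hg).congr (AEEqFun.coeFn_add f g).symm
  zero_mem' := (MemAnova.zero ρ ψ).congr AEEqFun.coeFn_zero.symm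
  smul_mem' c f hf := (MemAnova.smul c hf).congr (AEEqFun.coeFn_smul c f).symm

end Anova

end

/-!
For `f` in the space `W_d` let `P_u f` be the average of `∂^u f` over the variables outside `u`
against the densities. The theorem says that `f ↦ (P_u f)_u` identifies `W_d` with the Hilbert sum
`Model ψ γ` of the spaces `L²(ψ_u / γ_u dx_u)`, and that in this model point evaluations are inner
products with explicit vectors. The inner product of `W_d` is by definition the one pulled back
from the model.

*Injectivity* (`ae_eq_zero_of_innerInt_eq_zero`). Suppose all `P_u f` vanish. By downward induction
on `u`, each `∂^u f` vanishes: its derivatives in the variables outside `u` are zero, so it is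
invariant under translations in these variables and hence equal to its own average `P_u f`.

*Surjectivity* (`exists_toModel_eq`). For `h` in `L²(ψ_u dx_u)` consider
`f(y) = ∫ h(t) ∏_{j ∈ u} (Φ_j(t_j) - 1_{t_j > y_j}) dt`, a `potential`. As a function of `y_j` the
kernel jumps by `1` at `t_j`, so a derivative in `y_j` replaces the integral over `t_j` by the
evaluation at `t_j = y_j`, and derivatives in variables outside `u` vanish. As the kernel has mean
zero against `ρ_j(y_j) dy_j`, all averages of `f` vanish except `P_u f = h`. All integrals converge
by the inequality `ab ≤ a² w + b² / w`: the condition on `Φ_j` and `ψ_j` says that the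
square of the kernel divided by `ψ_j` is integrable, locally uniformly in `y_j`
(`integrable_stepBound_sq_div`). Weak derivatives in one direction are obtained from increments
(`hasWeakDeriv_of_increment`), and averages from Fubini's theorem (`innerInt_potential_aux`).

*Reproducing kernel*. The sum of the potentials is continuous and its value at `y` is the inner
product of `(P_u f)_u` with the vector `rep` with components
`γ_u ∏_{j ∈ u} (Φ_j(t_j) - 1_{t_j > y_j}) / ψ_j(t_j)`. The inner products of these vectors are
products of the integrals `∫ (Φ_j(t) - 1_{t > x_j}) (Φ_j(t) - 1_{t > y_j}) / ψ_j(t) dt`, which are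
`eta` (`integral_stepKer_mul_stepKer`).

To avoid integrals over spaces depending on `u`, potentials are written as integrals over all of
`ℝ^d`, with the superfluous variables integrated against the Gaussian probability density. It is
preferred to the densities `ρ_j` because it is locally bounded below, so that local integrability
can be tested against it.
-/

noncomputable section

namespace Anova

variable {d : ℕ}

/-! ### Calculus of weak mixed derivatives -/

theorem listDeriv_append (l l' : List (Fin d)) (v : (Fin d → ℝ) → ℝ) :
    listDeriv (l ++ l') v = listDeriv l (listDeriv l' v) := by
  induction l with
  | nil => rfl
  | cons j l ih => simp only [List.cons_append, listDeriv, ih]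

theorem listDeriv_perm {l l' : List (Fin d)} (h : l.Perm l') {v : (Fin d → ℝ) → ℝ}
    (hv : ContDiff ℝ ∞ v) (hc : HasCompactSupport v) : listDeriv l v = listDeriv l' v := by
  induction h with
  | nil => rfl
  | cons j _ ih => simp only [listDeriv, ih]
  | swap i j l =>
    obtain ⟨hs, -⟩ := listDeriv_smooth l hv hc
    funext x
    simp only [listDeriv]
    have hd : DifferentiableAt ℝ (fderiv ℝ (listDeriv l v)) x :=
      ((hs.fderiv_right (m := ∞) (by simp)).differentiable (by simp)) x
    rw [fderiv_clm_apply hd (by fun_prop), fderiv_clm_apply hd (by fun_prop)]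
    have hle : minSmoothness ℝ 2 ≤ ∞ := by
      rw [minSmoothness_of_isRCLikeNormedField]
      exact WithTop.coe_le_coe.2 le_top
    have hsymm : IsSymmSndFDerivAt ℝ (listDeriv l v) x :=
      (hs.contDiffAt (x := x)).isSymmSndFDerivAt hle
    simpa using hsymm.eq _ _
  | trans _ _ ih₁ ih₂ => exact ih₁.trans ih₂

theorem mixedDeriv_smooth (u : Finset (Fin d)) {v : (Fin d → ℝ) → ℝ} (hv : ContDiff ℝ ∞ v)
    (hc : HasCompactSupport v) :
    ContDiff ℝ ∞ (mixedDeriv u v) ∧ HasCompactSupport (mixedDeriv u v) :=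
  listDeriv_smooth _ hv hc

theorem mixedDeriv_union {u v : Finset (Fin d)} (huv : Disjoint u v) {φ : (Fin d → ℝ) → ℝ}
    (hφ : ContDiff ℝ ∞ φ) (hc : HasCompactSupport φ) :
    mixedDeriv (u ∪ v) φ = mixedDeriv u (mixedDeriv v φ) := by
  unfold mixedDeriv
  rw [← listDeriv_append]
  refine listDeriv_perm ?_ hφ hc
  rw [← Multiset.coe_eq_coe, ← Multiset.coe_add]
  simp only [Finset.sort_eq]
  rw [← Finset.disjUnion_eq_union u v huv]
  rfl

theorem mixedDeriv_singleton (i : Fin d) (φ : (Fin d → ℝ) → ℝ) :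
    mixedDeriv {i} φ = fun x => fderiv ℝ φ x (Pi.single i 1) := by
  simp [mixedDeriv, listDeriv]

theorem HasWeakDeriv.refl {f : (Fin d → ℝ) → ℝ} (hf : LocallyIntegrable f volume) :
    HasWeakDeriv ∅ f f :=
  ⟨hf, hf, fun v _ _ => by simp [mixedDeriv, listDeriv]⟩

theorem HasWeakDeriv.trans {u v : Finset (Fin d)} {f g k : (Fin d → ℝ) → ℝ}
    (huv : Disjoint u v) (h₁ : HasWeakDeriv u f g) (h₂ : HasWeakDeriv v g k) :
    HasWeakDeriv (u ∪ v) f k where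
  locInt := h₁.locInt
  locInt_deriv := h₂.locInt_deriv
  integral_eq φ hφ hc := by
    obtain ⟨hs, hsc⟩ := mixedDeriv_smooth v hφ hc
    rw [h₂.integral_eq φ hφ hc, h₁.integral_eq _ hs hsc, mixedDeriv_union huv hφ hc,
      Finset.card_union_of_disjoint huv]
    ring

/-- If `g = ∂^u f` and `k = ∂^(u ∪ v) f` with `u`, `v` disjoint, then `k = ∂^v g`. -/
theorem HasWeakDeriv.of_union {u v : Finset (Fin d)} {f g k : (Fin d → ℝ) → ℝ}
    (huv : Disjoint u v) (h₁ : HasWeakDeriv u f g) (h₂ : HasWeakDeriv (u ∪ v) f k) :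
    HasWeakDeriv v g k where
  locInt := h₁.locInt_deriv
  locInt_deriv := h₂.locInt_deriv
  integral_eq φ hφ hc := by
    obtain ⟨hs, hsc⟩ := mixedDeriv_smooth v hφ hc
    rw [h₂.integral_eq φ hφ hc, h₁.integral_eq _ hs hsc, mixedDeriv_union huv hφ hc,
      Finset.card_union_of_disjoint huv]
    ring

theorem HasWeakDeriv.congr_right {u : Finset (Fin d)} {f g g' : (Fin d → ℝ) → ℝ}
    (h : HasWeakDeriv u f g) (hgg : g =ᵐ[volume] g') : HasWeakDeriv u f g' where
  locInt := h.locInt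
  locInt_deriv := h.locInt_deriv.congr hgg
  integral_eq v hv hc := by
    rw [← h.integral_eq v hv hc]
    refine integral_congr_ae ?_
    filter_upwards [hgg] with x hx
    rw [hx]

theorem HasWeakDeriv.unique {u : Finset (Fin d)} {f g g' : (Fin d → ℝ) → ℝ}
    (h : HasWeakDeriv u f g) (h' : HasWeakDeriv u f g') : g =ᵐ[volume] g' := by
  refine ae_eq_of_integral_contDiff_smul_eq h.locInt_deriv h'.locInt_deriv fun v hv hc => ?_
  simp only [smul_eq_mul, mul_comm (v _)]
  rw [h.integral_eq v hv hc, h'.integral_eq v hv hc]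

theorem hasWeakDeriv_weakDeriv {u : Finset (Fin d)} {f g : (Fin d → ℝ) → ℝ}
    (h : HasWeakDeriv u f g) : HasWeakDeriv u f (weakDeriv u f) := by
  have h' : ∃ g, HasWeakDeriv u f g := ⟨g, h⟩
  unfold weakDeriv
  rw [dif_pos h']
  exact h'.choose_spec

theorem weakDeriv_ae_eq {u : Finset (Fin d)} {f g : (Fin d → ℝ) → ℝ}
    (h : HasWeakDeriv u f g) : weakDeriv u f =ᵐ[volume] g :=
  (hasWeakDeriv_weakDeriv h).unique h

/-! ### Weak derivatives and translations -/

theorem contDiff_translate {φ : (Fin d → ℝ) → ℝ} (hφ : ContDiff ℝ ∞ φ) (w : Fin d → ℝ) :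
    ContDiff ℝ ∞ (fun y => φ (y - w)) :=
  hφ.comp (contDiff_id.sub contDiff_const)

theorem hasCompactSupport_translate {φ : (Fin d → ℝ) → ℝ} (hc : HasCompactSupport φ)
    (w : Fin d → ℝ) : HasCompactSupport (fun y => φ (y - w)) :=
  hc.comp_homeomorph (Homeomorph.subRight w)

theorem mixedDeriv_singleton_translate (i : Fin d) (φ : (Fin d → ℝ) → ℝ) (w : Fin d → ℝ) :
    mixedDeriv {i} (fun y => φ (y - w)) = fun y => mixedDeriv {i} φ (y - w) := by
  simp only [mixedDeriv_singleton]
  funext y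
  rw [fderiv_comp_sub]

/-- Testing against translates is a convolution. -/
theorem integral_mul_translate_eq_convolution (f φ : (Fin d → ℝ) → ℝ) (w : Fin d → ℝ) :
    ∫ y, f y * φ (y - w) =
      (MeasureTheory.convolution f (fun x => φ (-x)) (ContinuousLinearMap.mul ℝ ℝ) volume) w := by
  simp [MeasureTheory.convolution]

/-- The derivative of `s ↦ ∫ f(y) φ(y - s e_i) dy` falls on the test function. -/
theorem hasDerivAt_integral_mul_translate {f φ : (Fin d → ℝ) → ℝ}
    (hf : LocallyIntegrable f volume) (hφ : ContDiff ℝ ∞ φ) (hc : HasCompactSupport φ)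
    (i : Fin d) (s : ℝ) :
    HasDerivAt (fun s : ℝ => ∫ y, f y * φ (y - s • Pi.single i 1))
      (-∫ y, f y * mixedDeriv {i} φ (y - s • Pi.single i 1)) s := by
  have hφ' : ContDiff ℝ ∞ (fun x => φ (-x)) := hφ.comp contDiff_neg
  have hc' : HasCompactSupport (fun x => φ (-x)) := hc.comp_homeomorph (Homeomorph.neg _)
  have h := hc'.hasFDerivAt_convolution_right (ContinuousLinearMap.mul ℝ ℝ) hf
    (hφ'.of_le (by simp)) (s • Pi.single i 1)
  have hl : HasDerivAt (fun s : ℝ => s • (Pi.single i 1 : Fin d → ℝ)) (Pi.single i 1) s := by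
    simpa using (hasDerivAt_id s).smul_const (Pi.single i 1 : Fin d → ℝ)
  have h2 := h.comp_hasDerivAt s hl
  simp_rw [integral_mul_translate_eq_convolution]
  convert! h2 using 1
  rw [convolution_precompR_apply _ hf (hc'.fderiv ℝ)
    ((hφ'.continuous_fderiv (by simp)))]
  rw [MeasureTheory.convolution, MeasureTheory.convolution, ← integral_neg]
  congr 1
  funext y
  have hd : fderiv ℝ (fun x => φ (-x)) (s • Pi.single i 1 - y)
      = -(fderiv ℝ φ (-(s • Pi.single i 1 - y))) := by
    have h0 : HasFDerivAt φ (fderiv ℝ φ (-(s • Pi.single i 1 - y))) (-(s • Pi.single i 1 - y)) :=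
      (hφ.differentiable (by simp) _).hasFDerivAt
    have h1 := h0.comp (s • Pi.single i 1 - y) ((hasFDerivAt_id (𝕜 := ℝ) _).neg)
    exact h1.fderiv.trans (by ext; simp)
  rw [hd, mixedDeriv_singleton]
  simp

theorem locallyIntegrable_translate {g : (Fin d → ℝ) → ℝ} (hg : LocallyIntegrable g volume)
    (w : Fin d → ℝ) : LocallyIntegrable (fun y => g (y + w)) volume := by
  rw [locallyIntegrable_iff]
  intro K hK
  have hK' : IsCompact ((fun y => y + w) '' K) := hK.image (by fun_prop)
  have h := (measurePreserving_add_right (volume : Measure (Fin d → ℝ)) w).integrableOn_image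
    (MeasurableEquiv.addRight w).measurableEmbedding (f := g) (s := K)
  exact h.1 (hg.integrableOn_isCompact hK')

/-- The integrability that allows to exchange the integrals over `y` and over the shift. -/
theorem integrable_translate_mul {g φ : (Fin d → ℝ) → ℝ} (hg : LocallyIntegrable g volume)
    (hφ : Continuous φ) (hc : HasCompactSupport φ) (i : Fin d) (t : ℝ) :
    Integrable (Function.uncurry fun (y : Fin d → ℝ) (s : ℝ) => g (y + s • Pi.single i 1) * φ y)
      (volume.prod (volume.restrict (Ioc 0 t))) := by
  set e : Fin d → ℝ := Pi.single i 1 with he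
  -- the support of the integrand is contained in the preimage of `K` under `(y, s) ↦ y + s e`
  set K : Set (Fin d → ℝ) := (fun p : (Fin d → ℝ) × ℝ => p.1 + p.2 • e) '' (tsupport φ ×ˢ Icc 0 t)
  have hK : IsCompact K := (hc.isCompact.prod isCompact_Icc).image (by fun_prop)
  have hmp : MeasurePreserving (fun p : ℝ × (Fin d → ℝ) => (p.1, p.2 + p.1 • e))
      ((volume.restrict (Ioc 0 t)).prod volume) ((volume.restrict (Ioc 0 t)).prod volume) :=
    (MeasurePreserving.id _).skew_product (g := fun s y => y + s • e) (by fun_prop)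
      (.of_forall fun s => (measurePreserving_add_right volume (s • e)).map_eq)
  have h1 : Integrable (fun p : ℝ × (Fin d → ℝ) => (1 : ℝ) * K.indicator g p.2)
      ((volume.restrict (Ioc 0 t)).prod volume) :=
    Integrable.mul_prod (f := fun _ : ℝ => (1 : ℝ)) (g := K.indicator g) (integrable_const _)
      ((integrable_indicator_iff hK.measurableSet).2 (hg.integrableOn_isCompact hK))
  have h2 := (hmp.integrable_comp h1.aestronglyMeasurable).2 h1
  obtain ⟨C, hC⟩ := hc.exists_bound_of_continuous hφ
  have h3 := h2.mul_bdd (g := fun p : ℝ × (Fin d → ℝ) => φ p.2) (c := C)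
    (hφ.comp continuous_snd).aestronglyMeasurable (.of_forall fun p => hC p.2)
  have h4 := h3.swap
  refine h4.congr ?_
  have hS : ∀ᵐ p : (Fin d → ℝ) × ℝ ∂(volume.prod (volume.restrict (Ioc 0 t))), p.2 ∈ Ioc 0 t :=
    Measure.quasiMeasurePreserving_snd.ae (ae_restrict_mem measurableSet_Ioc)
  filter_upwards [hS] with p hp
  simp only [Function.comp, Function.uncurry, Prod.fst_swap, Prod.snd_swap, one_mul]
  by_cases hpK : p.1 ∈ tsupport φ
  · rw [indicator_of_mem]
    exact ⟨p, ⟨hpK, Ioc_subset_Icc_self hp⟩, rfl⟩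
  · rw [image_eq_zero_of_notMem_tsupport hpK]
    simp

/-- If `f(y + h e_i) - f(y) = ∫_0^h g(y + s e_i) ds` for almost every `y`, for each `h > 0`,
then `g` is the weak derivative of `f` in the direction `e_i`. -/
theorem hasWeakDeriv_of_increment {f g : (Fin d → ℝ) → ℝ} (hf : LocallyIntegrable f volume)
    (hg : LocallyIntegrable g volume) (i : Fin d)
    (h : ∀ t : ℝ, 0 < t → ∀ᵐ y, f (y + t • Pi.single i 1) - f y =
      ∫ s in (0:ℝ)..t, g (y + s • Pi.single i 1)) : HasWeakDeriv {i} f g := by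
  refine ⟨hf, hg, fun φ hφ hc => ?_⟩
  -- the right derivative of `s ↦ ∫ f(y) φ(y - s e_i) dy` at `0` is computed in two ways
  have hF := hasDerivAt_integral_mul_translate hf hφ hc i 0
  have hGc : Continuous (fun s : ℝ => ∫ y, g y * φ (y - s • Pi.single i 1)) :=
    continuous_iff_continuousAt.2 fun s =>
      (hasDerivAt_integral_mul_translate hg hφ hc i s).continuousAt
  have htr : ∀ (k : (Fin d → ℝ) → ℝ) (w : Fin d → ℝ),
      ∫ y, k (y + w) * φ y = ∫ y, k y * φ (y - w) := fun k w => by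
    rw [← integral_add_right_eq_self (fun y => k y * φ (y - w)) w]
    simp
  have hcw : ∀ w : Fin d → ℝ, Integrable (fun y => f y * φ (y - w)) := fun w =>
    integrable_mul_test hf (hφ.continuous.comp (by fun_prop))
      (hasCompactSupport_translate hc w)
  have key : ∀ t : ℝ, 0 ≤ t → (∫ y, f y * φ (y - t • Pi.single i 1)) =
      (∫ y, f y * φ (y - (0:ℝ) • Pi.single i 1)) +
        ∫ s in (0:ℝ)..t, ∫ y, g y * φ (y - s • Pi.single i 1) := by
    intro t ht
    rcases ht.eq_or_lt with rfl | ht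
    · simp
    have h1 : (∫ y, f y * φ (y - t • Pi.single i 1)) - ∫ y, f y * φ y =
        ∫ y, (f (y + t • Pi.single i 1) - f y) * φ y := by
      rw [← htr, ← integral_sub]
      · simp [sub_mul]
      · have := (hcw (t • Pi.single i 1)).comp_add_right (t • Pi.single i 1)
        simpa using this
      · simpa using hcw 0
    have h2 : ∫ y, (f (y + t • Pi.single i 1) - f y) * φ y =
        ∫ y, ∫ s in Ioc (0:ℝ) t, g (y + s • Pi.single i 1) * φ y := by
      refine integral_congr_ae ?_
      filter_upwards [h t ht] with y hy
      rw [hy, intervalIntegral.integral_of_le ht.le, ← integral_mul_const]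
    have h3 : ∫ y, ∫ s in Ioc (0:ℝ) t, g (y + s • Pi.single i 1) * φ y =
        ∫ s in Ioc (0:ℝ) t, ∫ y, g (y + s • Pi.single i 1) * φ y := by
      exact integral_integral_swap (integrable_translate_mul hg hφ.continuous hc i t)
    simp only [zero_smul, sub_zero]
    rw [intervalIntegral.integral_of_le ht.le]
    simp_rw [← htr g]
    rw [← h3, ← h2, ← h1]
    ring
  have hR : HasDerivWithinAt (fun s : ℝ => ∫ y, f y * φ (y - s • Pi.single i 1))
      (∫ y, g y * φ (y - (0:ℝ) • Pi.single i 1)) (Ici 0) 0 := by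
    have h1 := (intervalIntegral.integral_hasDerivAt_right
      (hGc.intervalIntegrable 0 0)
      (hGc.stronglyMeasurableAtFilter _ _) hGc.continuousAt).const_add
      (∫ y, f y * φ (y - (0:ℝ) • Pi.single i 1))
    exact h1.hasDerivWithinAt.congr (fun t ht => key t ht) (key 0 le_rfl)
  have := (uniqueDiffWithinAt_Ici (0:ℝ)).eq_deriv _ hR hF.hasDerivWithinAt
  simpa using this

/-- A function with vanishing weak derivatives in the directions `e_i`, `i ∉ u`, is invariant
under translations in the variables outside `u`. -/
theorem ae_eq_translate_of_weakDeriv_zero {g : (Fin d → ℝ) → ℝ} {u : Finset (Fin d)}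
    (h : ∀ i ∉ u, HasWeakDeriv {i} g 0) (hg : LocallyIntegrable g volume)
    (w : Fin d → ℝ) (hw : ∀ i ∈ u, w i = 0) : ∀ᵐ y, g (y + w) = g y := by
  have hstep : ∀ i ∉ u, ∀ (s : ℝ) (φ : (Fin d → ℝ) → ℝ), ContDiff ℝ ∞ φ → HasCompactSupport φ →
      ∫ y, g y * φ (y - s • Pi.single i 1) = ∫ y, g y * φ y := by
    intro i hi s φ hφ hc
    have hd : ∀ s : ℝ, HasDerivAt (fun s : ℝ => ∫ y, g y * φ (y - s • Pi.single i 1)) 0 s := by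
      intro s
      have h1 := hasDerivAt_integral_mul_translate hg hφ hc i s
      have h2 := (h i hi).integral_eq _
        (contDiff_translate hφ (s • (Pi.single i 1 : Fin d → ℝ))) (hasCompactSupport_translate hc _)
      rw [mixedDeriv_singleton_translate] at h2
      simp only [Pi.zero_apply, zero_mul, integral_zero, Finset.card_singleton, pow_one] at h2
      convert h1 using 1
      linarith
    have h0 := is_const_of_deriv_eq_zero (fun s => (hd s).differentiableAt)
      (fun s => (hd s).deriv) s 0
    simp only [zero_smul, sub_zero] at h0
    exact h0
  -- a general shift is a composition of shifts in the coordinate directions outside `u`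
  have hall : ∀ (t : Finset (Fin d)) (w : Fin d → ℝ), Disjoint t u → (∀ i ∉ t, w i = 0) →
      ∀ (φ : (Fin d → ℝ) → ℝ), ContDiff ℝ ∞ φ → HasCompactSupport φ →
      ∫ y, g y * φ (y - w) = ∫ y, g y * φ y := by
    intro t
    induction t using Finset.induction_on with
    | empty =>
      intro w _ hw φ _ _
      have : w = 0 := funext fun i => hw i (by simp)
      simp [this]
    | insert i t hi ih =>
      intro w hd hw φ hφ hc
      rw [Finset.disjoint_insert_left] at hd
      have h1 := ih (w - w i • (Pi.single i 1 : Fin d → ℝ)) hd.2 (fun j hj => by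
        by_cases hji : j = i
        · subst hji; simp
        · simp [hji, hw j (by simp [hji, hj])]) _
        (contDiff_translate hφ (w i • (Pi.single i 1 : Fin d → ℝ)))
        (hasCompactSupport_translate hc _)
      rw [hstep i hd.1 (w i) φ hφ hc] at h1
      rw [← h1]
      congr 1
      funext y
      congr 2
      abel
  refine ae_eq_of_integral_contDiff_smul_eq ?_ hg fun φ hφ hc => ?_
  · exact locallyIntegrable_translate hg w
  · have := hall uᶜ w (by exact disjoint_compl_left) (fun i hi => hw i (by simpa using hi)) φ hφ hc
    simp only [smul_eq_mul, mul_comm (φ _)]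
    rw [← this, ← integral_add_right_eq_self (fun y => g y * φ (y - w)) w]
    simp

/-! ### The Gaussian reference measure -/

/-- The standard Gaussian density on the line. -/
def gpdf (t : ℝ) : ℝ := ProbabilityTheory.gaussianPDFReal 0 1 t

/-- The standard Gaussian probability measure on `ℝ^ι`. It serves to integrate over superfluous
variables: only its product structure and its positive continuous density matter. -/
def gaussPi (ι : Type*) [Fintype ι] : Measure (ι → ℝ) :=
  Measure.pi fun _ => ProbabilityTheory.gaussianReal 0 1

instance (ι : Type*) [Fintype ι] : IsProbabilityMeasure (gaussPi ι) := by
  unfold gaussPi; infer_instance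

theorem gpdf_pos (t : ℝ) : 0 < gpdf t :=
  ProbabilityTheory.gaussianPDFReal_pos 0 1 t one_ne_zero

theorem continuous_gpdf : Continuous gpdf := by
  unfold gpdf ProbabilityTheory.gaussianPDFReal
  fun_prop

theorem measurable_gpdf : Measurable gpdf := continuous_gpdf.measurable

theorem gaussianReal_eq_withDensity :
    ProbabilityTheory.gaussianReal 0 1 = volume.withDensity fun t => ENNReal.ofReal (gpdf t) :=
  ProbabilityTheory.gaussianReal_of_var_ne_zero 0 one_ne_zero

theorem integrable_gauss_iff {f : ℝ → ℝ} :
    Integrable f (ProbabilityTheory.gaussianReal 0 1) ↔ Integrable fun t => f t * gpdf t := by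
  rw [gaussianReal_eq_withDensity,
    integrable_withDensity_iff measurable_gpdf.ennreal_ofReal (.of_forall fun _ => by simp)]
  simp [ENNReal.toReal_ofReal (gpdf_pos _).le]

theorem integral_gauss (f : ℝ → ℝ) :
    ∫ t, f t ∂(ProbabilityTheory.gaussianReal 0 1) = ∫ t, f t * gpdf t := by
  rw [gaussianReal_eq_withDensity, integral_withDensity_eq_integral_toReal_smul
    measurable_gpdf.ennreal_ofReal (.of_forall fun _ => by simp)]
  simp [ENNReal.toReal_ofReal (gpdf_pos _).le, mul_comm]

section Pi

variable {ι : Type*} [Fintype ι]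

theorem measurable_prod_gpdf : Measurable fun x : ι → ℝ => ∏ i, gpdf (x i) :=
  Finset.measurable_fun_prod _ fun i _ => measurable_gpdf.comp (measurable_pi_apply i)

theorem prod_gpdf_pos (x : ι → ℝ) : 0 < ∏ i, gpdf (x i) :=
  Finset.prod_pos fun i _ => gpdf_pos (x i)

theorem gaussPi_eq_withDensity :
    gaussPi ι = volume.withDensity fun x => ENNReal.ofReal (∏ i, gpdf (x i)) := by
  refine Measure.pi_eq fun s hs => ?_
  rw [withDensity_apply _ (MeasurableSet.univ_pi hs)]
  have hi : ∀ i, IntegrableOn gpdf (s i) := fun i =>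
    (ProbabilityTheory.integrable_gaussianPDFReal 0 1).integrableOn
  rw [volume_pi, Measure.restrict_pi_pi, ← ofReal_integral_eq_lintegral_ofReal
    (Integrable.fintype_prod hi) (.of_forall fun x => (prod_gpdf_pos x).le),
    integral_fintype_prod_eq_prod, ENNReal.ofReal_prod_of_nonneg
    (fun i _ => integral_nonneg fun t => (gpdf_pos t).le)]
  refine Finset.prod_congr rfl fun i _ => ?_
  rw [ProbabilityTheory.gaussianReal_apply_eq_integral 0 one_ne_zero (s i)]
  rfl

theorem integrable_gaussPi_iff {f : (ι → ℝ) → ℝ} :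
    Integrable f (gaussPi ι) ↔ Integrable fun x => f x * ∏ i, gpdf (x i) := by
  rw [gaussPi_eq_withDensity,
    integrable_withDensity_iff measurable_prod_gpdf.ennreal_ofReal (.of_forall fun _ => by simp)]
  simp [ENNReal.toReal_ofReal (prod_gpdf_pos _).le]

theorem integral_gaussPi (f : (ι → ℝ) → ℝ) :
    ∫ x, f x ∂(gaussPi ι) = ∫ x, f x * ∏ i, gpdf (x i) := by
  rw [gaussPi_eq_withDensity, integral_withDensity_eq_integral_toReal_smul
    measurable_prod_gpdf.ennreal_ofReal (.of_forall fun _ => by simp)]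
  simp [ENNReal.toReal_ofReal (prod_gpdf_pos _).le, mul_comm]

theorem ae_gaussPi : ae (gaussPi ι) = ae volume := by
  rw [gaussPi_eq_withDensity]
  refine le_antisymm (withDensity_absolutelyContinuous _ _).ae_le
    (withDensity_absolutelyContinuous' measurable_prod_gpdf.ennreal_ofReal.aemeasurable
      (.of_forall fun x => ?_)).ae_le
  simp [prod_gpdf_pos x]

end Pi

theorem locallyIntegrable_of_gaussPi {F : (Fin d → ℝ) → ℝ}
    (h : ∀ R : ℝ, IntegrableOn F (Icc (fun _ => -R) fun _ => R) (gaussPi (Fin d))) :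
    LocallyIntegrable F volume := by
  have h1 : LocallyIntegrable (fun x => F x * ∏ i, gpdf (x i)) volume := by
    rw [locallyIntegrable_iff]
    intro K hK
    obtain ⟨R, hR⟩ := hK.isBounded.subset_closedBall 0
    have hsub : K ⊆ Icc (fun _ => -R) fun _ => R := by
      refine hR.trans ?_
      intro x hx
      rw [mem_closedBall_zero_iff] at hx
      have hj : ∀ j, |x j| ≤ R := fun j => (norm_le_pi_norm x j).trans hx
      exact ⟨fun j => (abs_le.1 (hj j)).1, fun j => (abs_le.1 (hj j)).2⟩
    refine IntegrableOn.mono_set ?_ hsub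
    have h2 := h R
    rw [← integrable_indicator_iff measurableSet_Icc, integrable_gaussPi_iff] at h2
    rw [← integrable_indicator_iff measurableSet_Icc]
    refine h2.congr (.of_forall fun x => ?_)
    by_cases hx : x ∈ Icc (fun _ : Fin d => -R) fun _ => R <;> simp [hx]
  have hc : Continuous fun x : Fin d → ℝ => (∏ i, gpdf (x i))⁻¹ :=
    (continuous_finsetProd _ fun i _ => continuous_gpdf.comp (continuous_apply i)).inv₀
      fun x => (prod_gpdf_pos x).ne'
  have h3 := (locallyIntegrableOn_univ.2 h1).mul_continuousOn hc.continuousOn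
    isOpen_univ.isLocallyClosed
  refine (locallyIntegrableOn_univ.1 h3).congr (.of_forall fun x => ?_)
  simp only
  rw [mul_assoc, mul_inv_cancel₀ (prod_gpdf_pos x).ne', mul_one]

/-! ### Splitting coordinates -/

theorem measurable_piecewise (v : Finset (Fin d)) :
    Measurable fun p : (Fin d → ℝ) × (Fin d → ℝ) => v.piecewise p.1 p.2 := by
  refine measurable_pi_iff.2 fun j => ?_
  by_cases hj : j ∈ v
  · simp only [Finset.piecewise_eq_of_mem _ _ _ hj]; fun_prop
  · simp only [Finset.piecewise_eq_of_notMem _ _ _ hj]; fun_prop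

theorem measurePreserving_piecewise (v : Finset (Fin d)) :
    MeasurePreserving (fun p : (Fin d → ℝ) × (Fin d → ℝ) => v.piecewise p.1 p.2)
      ((gaussPi (Fin d)).prod (gaussPi (Fin d))) (gaussPi (Fin d)) := by
  refine ⟨measurable_piecewise v, (Measure.pi_eq fun s hs => ?_).symm⟩
  rw [Measure.map_apply (measurable_piecewise v) (MeasurableSet.univ_pi hs)]
  have : (fun p : (Fin d → ℝ) × (Fin d → ℝ) => v.piecewise p.1 p.2) ⁻¹' (univ.pi s) =
      (univ.pi fun j => if j ∈ v then s j else univ) ×ˢ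
        (univ.pi fun j => if j ∈ v then univ else s j) := by
    ext p
    simp only [mem_preimage, mem_pi, mem_univ, true_implies, mem_prod, ← forall_and]
    refine forall_congr' fun j => ?_
    by_cases hj : j ∈ v <;> simp [hj]
  rw [this, Measure.prod_prod, gaussPi, Measure.pi_pi, Measure.pi_pi, ← Finset.prod_mul_distrib]
  refine Finset.prod_congr rfl fun j _ => ?_
  by_cases hj : j ∈ v <;> simp [hj]

theorem measurePreserving_update (i : Fin d) :
    MeasurePreserving (fun p : ℝ × (Fin d → ℝ) => Function.update p.2 i p.1)
      ((ProbabilityTheory.gaussianReal 0 1).prod (gaussPi (Fin d))) (gaussPi (Fin d)) := by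
  have hm : Measurable fun p : ℝ × (Fin d → ℝ) => Function.update p.2 i p.1 := by
    refine measurable_pi_iff.2 fun j => ?_
    by_cases hj : j = i
    · subst hj; simp only [Function.update_self]; fun_prop
    · simp only [Function.update_of_ne hj]; fun_prop
  refine ⟨hm, (Measure.pi_eq fun s hs => ?_).symm⟩
  rw [Measure.map_apply hm (MeasurableSet.univ_pi hs)]
  have : (fun p : ℝ × (Fin d → ℝ) => Function.update p.2 i p.1) ⁻¹' (univ.pi s) =
      s i ×ˢ (univ.pi fun j => if j = i then univ else s j) := by
    ext p
    simp only [mem_preimage, mem_pi, mem_univ, true_implies, mem_prod]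
    constructor
    · intro h
      refine ⟨by simpa using h i, fun j => ?_⟩
      by_cases hj : j = i
      · simp [hj]
      · simpa [hj] using h j
    · rintro ⟨h1, h2⟩ j
      by_cases hj : j = i
      · subst hj; simpa using h1
      · simpa [hj] using h2 j
  rw [this, Measure.prod_prod, gaussPi, Measure.pi_pi,
    ← Finset.mul_prod_erase _ _ (Finset.mem_univ i),
    ← Finset.mul_prod_erase _ _ (Finset.mem_univ i)]
  simp only [if_true, measure_univ, one_mul]
  congr 1
  refine Finset.prod_congr rfl fun j hj => ?_
  simp [Finset.ne_of_mem_erase hj]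

/-- The coordinates of `y` in `u`. -/
def proj (u : Finset (Fin d)) (y : Fin d → ℝ) : {j // j ∈ u} → ℝ := fun j => y j

theorem measurable_proj (u : Finset (Fin d)) : Measurable (proj u) := by
  unfold proj; fun_prop

theorem measurePreserving_proj (u : Finset (Fin d)) :
    MeasurePreserving (proj u) (gaussPi (Fin d)) (gaussPi {j // j ∈ u}) := by
  have h := measurePreserving_piEquivPiSubtypeProd
    (fun _ : Fin d => ProbabilityTheory.gaussianReal 0 1) (fun j => j ∈ u)
  unfold gaussPi
  convert measurePreserving_fst.comp h using 1
  · rfl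
  · exact congrArg (fun inst : Fintype {j // j ∈ u} => @Measure.pi _ _ inst _
    fun _ => ProbabilityTheory.gaussianReal 0 1) (Subsingleton.elim _ _)

@[simp]
theorem proj_glue (u : Finset (Fin d)) (xu : {j // j ∈ u} → ℝ) (z : {j // j ∉ u} → ℝ) :
    proj u (glue u xu z) = xu := by
  funext j
  simp [proj, glue, j.2]

/-- An almost everywhere statement on `ℝ^d` is one along almost every slice. -/
theorem ae_glue {u : Finset (Fin d)} {P : (Fin d → ℝ) → Prop} (h : ∀ᵐ y, P y) :
    ∀ᵐ xu, ∀ᵐ z, P (glue u xu z) :=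
  Measure.ae_ae_of_ae_prod ((measurePreserving_glue u).quasiMeasurePreserving.ae h)

theorem ae_of_ae_proj {u : Finset (Fin d)} {P : ({j // j ∈ u} → ℝ) → Prop}
    (h : ∀ᵐ y : Fin d → ℝ, P (proj u y)) : ∀ᵐ xu, P xu := by
  filter_upwards [ae_glue (u := u) h] with xu hx
  obtain ⟨z, hz⟩ := hx.exists
  simpa using hz

theorem ae_proj_of_ae {u : Finset (Fin d)} {P : ({j // j ∈ u} → ℝ) → Prop}
    (h : ∀ᵐ xu, P xu) : ∀ᵐ y : Fin d → ℝ, P (proj u y) := by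
  rw [← ae_gaussPi] at h ⊢
  exact (measurePreserving_proj u).quasiMeasurePreserving.ae h

/-! ### Uniqueness -/

theorem innerInt_congr_ae (ρ : Fin d → ℝ → ℝ) (u : Finset (Fin d)) {g g' : (Fin d → ℝ) → ℝ}
    (h : g =ᵐ[volume] g') :
    ∀ᵐ xu, (fun z => g (glue u xu z) * rhoCompl ρ u z) =ᵐ[volume]
      fun z => g' (glue u xu z) * rhoCompl ρ u z := by
  filter_upwards [ae_glue (u := u) h] with xu hx
  filter_upwards [hx] with z hz
  rw [hz]

theorem integral_rhoCompl {ρ : Fin d → ℝ → ℝ} (hρ_one : ∀ j, ∫ t, ρ j t = 1)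
    (u : Finset (Fin d)) : ∫ z, rhoCompl ρ u z = 1 := by
  unfold rhoCompl
  rw [integral_fintype_prod_volume_eq_prod (fun j : {j // j ∉ u} => ρ j.1)]
  simp [hρ_one]

/-- A function invariant under translations in the variables outside `u` is, for almost every
`x_u`, almost everywhere equal to its average over these variables. -/
theorem ae_eq_innerInt_of_translate {ρ : Fin d → ℝ → ℝ} (hρ_one : ∀ j, ∫ t, ρ j t = 1)
    {g : (Fin d → ℝ) → ℝ} {u : Finset (Fin d)} (hg : AEStronglyMeasurable g volume)
    (h : ∀ w : Fin d → ℝ, (∀ i ∈ u, w i = 0) → ∀ᵐ y, g (y + w) = g y) :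
    ∀ᵐ y, g y = innerInt ρ u g (proj u y) := by
  wlog hgm : StronglyMeasurable g generalizing g
  · have hk := hg.ae_eq_mk
    have := this hg.stronglyMeasurable_mk.aestronglyMeasurable (fun w hw => by
      filter_upwards [h w hw, hk,
        (measurePreserving_add_right volume w).quasiMeasurePreserving.ae hk] with y h1 h2 h3
      rw [← h2, ← h3, h1]) hg.stronglyMeasurable_mk
    filter_upwards [this, hk, ae_proj_of_ae (innerInt_congr_ae ρ u hk)] with y h1 h2 h3
    rw [h2, h1, innerInt, innerInt, integral_congr_ae h3]
  have hz : ∀ z : Fin d → ℝ, ∀ᵐ y, g (y + u.piecewise 0 z) = g y := fun z =>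
    h _ fun i hi => by simp [hi]
  have hmeas : Measurable fun p : (Fin d → ℝ) × (Fin d → ℝ) => p.2 + u.piecewise 0 p.1 :=
    measurable_snd.add ((measurable_piecewise u).comp (measurable_const.prodMk measurable_fst))
  -- in the variables `(z, y)`, shifting `z` by `-y` turns `y + z` into `z` outside `u`
  have h1 : ∀ᵐ p : (Fin d → ℝ) × (Fin d → ℝ) ∂(volume.prod volume),
      g (p.2 + u.piecewise 0 p.1) = g p.2 :=
    (Measure.ae_prod_iff_ae_ae (measurableSet_eq_fun (hgm.measurable.comp hmeas)
      (hgm.measurable.comp measurable_snd))).2 (.of_forall hz)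
  have h2 : ∀ᵐ p : (Fin d → ℝ) × (Fin d → ℝ) ∂(volume.prod volume),
      g (p.1 + u.piecewise 0 p.2) = g p.1 :=
    Measure.measurePreserving_swap.quasiMeasurePreserving.ae h1
  have hmp : MeasurePreserving (fun p : (Fin d → ℝ) × (Fin d → ℝ) => (p.1, p.2 - p.1))
      (volume.prod volume) (volume.prod volume) :=
    (MeasurePreserving.id _).skew_product (g := fun y z => z - y) (by fun_prop)
      (.of_forall fun y => (measurePreserving_sub_right volume y).map_eq)
  have h3 := Measure.ae_ae_of_ae_prod (hmp.quasiMeasurePreserving.ae h2)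
  filter_upwards [h3] with y hy
  have hy' : ∀ᵐ z : {j // j ∉ u} → ℝ, g (glue u (proj u y) z) = g y := by
    have h4 : ∀ᵐ z : {j // j ∈ u} → ℝ, ∀ᵐ z' : {j // j ∉ u} → ℝ,
        g (y + u.piecewise 0 (glue u z z' - y)) = g y := ae_glue (u := u) hy
    obtain ⟨z, hz⟩ := h4.exists
    filter_upwards [hz] with z' hz'
    rw [← hz']
    congr 1
    funext j
    by_cases hj : j ∈ u <;> simp [glue, proj, hj]
  have : innerInt ρ u g (proj u y) = ∫ z, g y * rhoCompl ρ u z := by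
    refine integral_congr_ae ?_
    filter_upwards [hy'] with z hz
    rw [hz]
  rw [this, integral_const_mul, integral_rhoCompl hρ_one, mul_one]

/-- A function whose averaged weak derivatives `P_u f` all vanish is zero: by downward induction
on `u`, each `∂^u f` vanishes, since it is constant in the variables outside `u` and hence equal
to its own average over them. -/
theorem ae_eq_zero_of_innerInt_eq_zero {ρ : Fin d → ℝ → ℝ} (hρ_one : ∀ j, ∫ t, ρ j t = 1)
    {f : (Fin d → ℝ) → ℝ} {D : Finset (Fin d) → (Fin d → ℝ) → ℝ}
    (hD : ∀ u, HasWeakDeriv u f (D u)) (h0 : ∀ u, innerInt ρ u (D u) =ᵐ[volume] 0) :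
    f =ᵐ[volume] 0 := by
  have key : ∀ (n : ℕ) (u : Finset (Fin d)), uᶜ.card = n → D u =ᵐ[volume] 0 := by
    intro n
    induction n using Nat.strong_induction_on with
    | _ n ih =>
      intro u hu
      have hz : ∀ i ∉ u, HasWeakDeriv {i} (D u) 0 := fun i hi => by
        have hdis : Disjoint u {i} := Finset.disjoint_singleton_right.2 hi
        have hlt : (u ∪ {i})ᶜ.card < n := by
          rw [← hu]
          refine Finset.card_lt_card (Finset.compl_ssubset_compl.2 ?_)
          exact Finset.ssubset_iff_subset_ne.2 ⟨Finset.subset_union_left, fun h => hi (h ▸ by simp)⟩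
        exact ((hD u).of_union hdis (hD _)).congr_right (ih _ hlt _ rfl)
      have h1 := ae_eq_innerInt_of_translate hρ_one (hD u).locInt_deriv.aestronglyMeasurable
        (ae_eq_translate_of_weakDeriv_zero hz (hD u).locInt_deriv)
      filter_upwards [h1, ae_proj_of_ae (h0 u)] with y hy hy0
      rw [hy, hy0]
      rfl
  have h1 := key _ ∅ rfl
  have h2 : HasWeakDeriv ∅ f f := .refl (hD ∅).locInt
  exact (h2.unique (hD ∅)).trans h1

/-! ### The univariate kernel -/

section Univariate

variable {r p : ℝ → ℝ}

theorem distFun_nonneg (hr : ∀ t, 0 < r t) (t : ℝ) : 0 ≤ distFun r t :=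
  integral_nonneg fun s => (hr s).le

theorem one_sub_distFun (hri : Integrable r) (hr1 : ∫ t, r t = 1) (t : ℝ) :
    1 - distFun r t = ∫ s in Ici t, r s := by
  have h := integral_add_compl (measurableSet_Iic (a := t)) hri
  rw [hr1, compl_Iic] at h
  rw [integral_Ici_eq_integral_Ioi, ← h, distFun]
  ring

theorem distFun_le_one (hr : ∀ t, 0 < r t) (hri : Integrable r) (hr1 : ∫ t, r t = 1) (t : ℝ) :
    distFun r t ≤ 1 := by
  have h : 0 ≤ ∫ s in Ici t, r s := integral_nonneg fun s => (hr s).le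
  rw [← one_sub_distFun hri hr1 t] at h
  linarith

theorem measurable_distFun (hr : ∀ t, 0 < r t) (hri : Integrable r) : Measurable (distFun r) := by
  refine Monotone.measurable fun a b hab => ?_
  exact setIntegral_mono_set hri.integrableOn (.of_forall fun s => (hr s).le)
    (Iic_subset_Iic.2 hab).eventuallyLE

/-- The function `Φ(t) - 1_{t > y}` of `t`, for which
`f(y) - ∫ f r = ∫ f'(t) (Φ(t) - 1_{t > y}) dt`. -/
def stepKer (r : ℝ → ℝ) (y t : ℝ) : ℝ := distFun r t - if y < t then 1 else 0

/-- A bound for `|stepKer r y|` that holds for all `y ∈ [-R, R]`. -/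
def stepBound (r : ℝ → ℝ) (R t : ℝ) : ℝ :=
  (if t ≤ R then distFun r t else 0) + if -R ≤ t then 1 - distFun r t else 0

theorem measurable_stepKer (hr : ∀ t, 0 < r t) (hri : Integrable r) :
    Measurable fun q : ℝ × ℝ => stepKer r q.1 q.2 :=
  ((measurable_distFun hr hri).comp measurable_snd).sub
    (Measurable.ite (measurableSet_lt measurable_fst measurable_snd) measurable_const
      measurable_const)

theorem measurable_stepBound (hr : ∀ t, 0 < r t) (hri : Integrable r) (R : ℝ) :
    Measurable (stepBound r R) :=
  ((measurable_distFun hr hri).ite measurableSet_Iic measurable_const).add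
    (((measurable_distFun hr hri).const_sub 1).ite measurableSet_Ici measurable_const)

theorem abs_stepKer_le (hr : ∀ t, 0 < r t) (hri : Integrable r) (hr1 : ∫ t, r t = 1)
    {R y : ℝ} (hy : |y| ≤ R) (t : ℝ) : |stepKer r y t| ≤ stepBound r R t := by
  have h0 := distFun_nonneg hr t
  have h1 := distFun_le_one hr hri hr1 t
  obtain ⟨ha, hb⟩ := abs_le.1 hy
  unfold stepKer stepBound
  by_cases hyt : y < t
  · rw [if_pos hyt, if_pos (by linarith : -R ≤ t), abs_of_nonpos (by linarith)]
    split_ifs <;> linarith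
  · rw [if_neg hyt, if_pos (by linarith : t ≤ R), abs_of_nonneg (by linarith)]
    split_ifs <;> linarith

theorem distFun_mul_le_stepBound (hr : ∀ t, 0 < r t) (hri : Integrable r) (hr1 : ∫ t, r t = 1)
    (t : ℝ) : distFun r t * (1 - distFun r t) ≤ stepBound r 0 t := by
  have h0 := distFun_nonneg hr t
  have h1 := distFun_le_one hr hri hr1 t
  unfold stepBound
  rcases le_total t 0 with ht | ht
  · rw [if_pos ht]
    split_ifs <;> nlinarith
  · rw [if_pos (by simpa using ht : -0 ≤ t)]
    split_ifs <;> nlinarith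

theorem integrable_stepBound_sq_div (hr : ∀ t, 0 < r t) (hri : Integrable r)
    (hp : ∀ t, 0 < p t) (hpm : AEStronglyMeasurable p) (hw : WeakerCondition r p) (R : ℝ) :
    Integrable fun t => stepBound r R t ^ 2 / p t := by
  have h1 := (integrable_indicator_iff measurableSet_Iic).2 (hw R).1
  have h2 := (integrable_indicator_iff measurableSet_Ici).2 (hw (-R)).2
  refine ((h1.const_mul 2).add (h2.const_mul 2)).mono'
    ((((measurable_stepBound hr hri R).pow_const 2).aemeasurable.div
      hpm.aemeasurable).aestronglyMeasurable) (.of_forall fun t => ?_)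
  have hpt := hp t
  rw [Real.norm_of_nonneg (by positivity)]
  simp only [Pi.add_apply, indicator, mem_Iic, mem_Ici, stepBound]
  have : ∀ a b : ℝ, (a + b) ^ 2 / p t ≤ 2 * (a ^ 2 / p t) + 2 * (b ^ 2 / p t) := fun a b => by
    rw [← mul_div_assoc, ← mul_div_assoc, ← add_div]
    gcongr
    nlinarith [sq_nonneg (a - b)]
  convert this _ _ using 3
  · split_ifs <;> simp
  · split_ifs <;> simp

theorem integrable_stepKer_mul (hri : Integrable r) (t : ℝ) :
    Integrable fun y => stepKer r y t * r y := by
  have h : Integrable ((Iio t).indicator r) := hri.indicator measurableSet_Iio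
  refine ((hri.const_mul (distFun r t)).sub h).congr (.of_forall fun y => ?_)
  by_cases hy : y < t <;> simp [stepKer, indicator, hy, sub_mul]

/-- The kernel has mean zero in its first variable. -/
theorem integral_stepKer_mul (hri : Integrable r) (hr1 : ∫ t, r t = 1) (t : ℝ) :
    ∫ y, stepKer r y t * r y = 0 := by
  have h : Integrable ((Iio t).indicator r) := hri.indicator measurableSet_Iio
  have he : (fun y => stepKer r y t * r y) =
      fun y => distFun r t * r y - (Iio t).indicator r y := by
    funext y
    by_cases hy : y < t <;> simp [stepKer, indicator, hy, sub_mul]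
  rw [he, integral_sub (hri.const_mul _) h, integral_const_mul, hr1,
    integral_indicator measurableSet_Iio, ← integral_Iic_eq_integral_Iio]
  simp [distFun]

theorem integral_abs_stepKer_mul (hr : ∀ t, 0 < r t) (hri : Integrable r) (hr1 : ∫ t, r t = 1)
    (t : ℝ) : ∫ y, |stepKer r y t| * r y = 2 * (distFun r t * (1 - distFun r t)) := by
  have h0 := distFun_nonneg hr t
  have h1 := distFun_le_one hr hri hr1 t
  have hA : Integrable ((Iio t).indicator r) := hri.indicator measurableSet_Iio
  have hB : Integrable ((Ici t).indicator r) := hri.indicator measurableSet_Ici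
  have he : (fun y => |stepKer r y t| * r y) = fun y =>
      (1 - distFun r t) * (Iio t).indicator r y + distFun r t * (Ici t).indicator r y := by
    funext y
    by_cases hy : y < t
    · have : ¬ t ≤ y := not_le.2 hy
      simp only [stepKer, indicator, hy, this, if_true, if_false, mem_Iio, mem_Ici]
      rw [abs_of_nonpos (by linarith)]
      ring
    · have h' : t ≤ y := not_lt.1 hy
      simp only [stepKer, indicator, hy, h', if_true, if_false, mem_Iio, mem_Ici]
      rw [sub_zero, abs_of_nonneg h0]
      ring
  rw [he, integral_add (hA.const_mul _) (hB.const_mul _), integral_const_mul, integral_const_mul,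
    integral_indicator measurableSet_Iio, integral_indicator measurableSet_Ici,
    ← integral_Iic_eq_integral_Iio, ← one_sub_distFun hri hr1]
  change (1 - distFun r t) * distFun r t + _ = _
  ring

theorem stepKer_add_sub (r : ℝ → ℝ) (y t : ℝ) {h : ℝ} (hh : 0 ≤ h) :
    stepKer r (y + h) t - stepKer r y t = (Ioc y (y + h)).indicator 1 t := by
  simp only [stepKer, indicator, mem_Ioc, Pi.one_apply]
  by_cases h1 : y < t <;> by_cases h2 : t ≤ y + h
  · simp [h1, h2, not_lt.2 h2]
  · simp [h2, not_le.1 h2, h1]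
  · simp [h1, not_lt.2 h2]
  · exact absurd ((not_lt.1 h1).trans (by linarith)) h2

theorem continuousAt_stepKer (r : ℝ → ℝ) {y t : ℝ} (h : t ≠ y) :
    ContinuousAt (fun y => stepKer r y t) y := by
  refine continuousAt_const.congr (f := fun _ => stepKer r y t) ?_
  rcases lt_or_gt_of_ne h with h | h
  · filter_upwards [lt_mem_nhds h] with y' hy'
    simp [stepKer, not_lt.2 h.le, not_lt.2 (le_of_lt hy')]
  · filter_upwards [gt_mem_nhds h] with y' hy'
    have h1 : y < t := h
    have h2 : y' < t := hy'
    simp [stepKer, h1, h2]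

theorem integral_stepKer_mul_stepKer (hr : ∀ t, 0 < r t) (hri : Integrable r)
    (hr1 : ∫ t, r t = 1) (hp : ∀ t, 0 < p t) (hpm : AEStronglyMeasurable p)
    (hw : WeakerCondition r p) (x y : ℝ) :
    ∫ t, stepKer r x t * stepKer r y t / p t = eta r p x y := by
  have hmk : ∀ x, Measurable fun t => stepKer r x t := fun x =>
    (measurable_stepKer hr hri).comp (measurable_const.prodMk measurable_id)
  have hint : Integrable fun t => stepKer r x t * stepKer r y t / p t := by
    refine (integrable_stepBound_sq_div hr hri hp hpm hw (max |x| |y|)).mono'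
      ((((hmk x).mul (hmk y)).aemeasurable.div hpm.aemeasurable).aestronglyMeasurable)
      (.of_forall fun t => ?_)
    rw [norm_div, norm_mul, sq, Real.norm_of_nonneg (hp t).le]
    have h1 := abs_stepKer_le hr hri hr1 (le_max_left |x| |y|) t
    have h2 := abs_stepKer_le hr hri hr1 (le_max_right |x| |y|) t
    have := (hp t).le
    gcongr
    · exact (abs_nonneg _).trans h1
    · exact h1
    · exact h2
  set a := min x y
  set b := max x y
  have hab : a ≤ b := min_le_max
  rw [← integral_add_compl (measurableSet_Iic (a := a)) hint, compl_Iic,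
    ← Ioc_union_Ioi_eq_Ioi hab, setIntegral_union (Set.Ioc_disjoint_Ioi le_rfl) measurableSet_Ioi
      hint.integrableOn hint.integrableOn]
  have e1 : ∫ t in Iic a, stepKer r x t * stepKer r y t / p t =
      ∫ t in Iic a, distFun r t ^ 2 / p t := by
    refine setIntegral_congr_fun measurableSet_Iic fun t ht => ?_
    have h1 : ¬ x < t := not_lt.2 (le_trans ht (min_le_left _ _))
    have h2 : ¬ y < t := not_lt.2 (le_trans ht (min_le_right _ _))
    simp only [stepKer, h1, h2, if_false]
    ring
  have e2 : ∫ t in Ioi b, stepKer r x t * stepKer r y t / p t =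
      ∫ t in Ici b, (1 - distFun r t) ^ 2 / p t := by
    rw [integral_Ici_eq_integral_Ioi]
    refine setIntegral_congr_fun measurableSet_Ioi fun t ht => ?_
    have h1 : x < t := lt_of_le_of_lt (le_max_left _ _) ht
    have h2 : y < t := lt_of_le_of_lt (le_max_right _ _) ht
    simp only [stepKer, h1, h2, if_true]
    ring
  have e3 : ∫ t in Ioc a b, stepKer r x t * stepKer r y t / p t =
      -∫ t in a..b, distFun r t * (1 - distFun r t) / p t := by
    rw [intervalIntegral.integral_of_le hab, ← integral_neg]
    refine setIntegral_congr_fun measurableSet_Ioc fun t ht => ?_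
    have : (x < t ∧ ¬ y < t) ∨ (¬ x < t ∧ y < t) := by
      have h1 := ht.1
      have h2 := ht.2
      rcases le_total x y with hxy | hxy
      · left
        rw [show a = x from min_eq_left hxy] at h1
        rw [show b = y from max_eq_right hxy] at h2
        exact ⟨h1, not_lt.2 h2⟩
      · right
        rw [show a = y from min_eq_right hxy] at h1
        rw [show b = x from max_eq_left hxy] at h2
        exact ⟨not_lt.2 h2, h1⟩
    rcases this with ⟨h1, h2⟩ | ⟨h1, h2⟩ <;> simp only [stepKer, h1, h2, if_true, if_false] <;> ring
  rw [e1, e2, e3, eta]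
  ring

end Univariate

section

/-! ### Potentials -/

/-- The hypotheses on the densities and weights. -/
structure Admissible (ρ ψ : Fin d → ℝ → ℝ) : Prop where
  pos : ∀ j t, 0 < ρ j t
  integrable : ∀ j, Integrable (ρ j) volume
  integral_eq_one : ∀ j, ∫ t, ρ j t = 1
  weight_pos : ∀ j t, 0 < ψ j t
  weight : ∀ j, LocallyIntegrable (ψ j) volume
  inv_weight : ∀ j, LocallyIntegrable (fun t => 1 / ψ j t) volume
  cond : ∀ j, WeakerCondition (ρ j) (ψ j)

/-- For `v ⊆ u`, the function `∫ h(y_v, t_{u∖v}) ∏_{j ∈ u∖v} (Φ_j(t_j) - 1_{t_j > y_j}) dt_{u∖v}`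
of `y`. The integral is written over all of `ℝ^d` against the Gaussian measure, the variables
outside `u∖v` being superfluous, so that the domain does not depend on `u` and `v`. For `v = ∅`
this is the component in `u` of the function with `P_u f = h`; the general case is its
derivative `∂^v`. -/
def potential (ρ : Fin d → ℝ → ℝ) (u : Finset (Fin d)) (h : ({j // j ∈ u} → ℝ) → ℝ)
    (v : Finset (Fin d)) (y : Fin d → ℝ) : ℝ :=
  ∫ t, h (proj u (v.piecewise y t)) * ∏ j ∈ u \ v, (stepKer (ρ j) (y j) (t j) / gpdf (t j))
    ∂(gaussPi (Fin d))

/-- The integrand of `∫ h² ψ_u`, with respect to the Gaussian measure. -/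
def energy (ψ : Fin d → ℝ → ℝ) (u : Finset (Fin d)) (h : ({j // j ∈ u} → ℝ) → ℝ)
    (t : Fin d → ℝ) : ℝ :=
  h (proj u t) ^ 2 * ∏ j ∈ u, (ψ j (t j) / gpdf (t j))

variable {ρ ψ : Fin d → ℝ → ℝ} {u v : Finset (Fin d)} {h : ({j // j ∈ u} → ℝ) → ℝ}

theorem integrable_energy (h2 : Integrable fun x => h x ^ 2 * psiProd ψ u x) :
    Integrable (energy ψ u h) (gaussPi (Fin d)) := by
  have h3 : Integrable (fun x : {j // j ∈ u} → ℝ => h x ^ 2 * ∏ j, (ψ j.1 (x j) / gpdf (x j)))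
      (gaussPi {j // j ∈ u}) := by
    rw [integrable_gaussPi_iff]
    refine h2.congr (.of_forall fun x => ?_)
    simp only [psiProd]
    rw [mul_assoc, ← Finset.prod_mul_distrib]
    congr 1
    refine Finset.prod_congr rfl fun j _ => ?_
    rw [div_mul_cancel₀ _ (gpdf_pos _).ne']
  have h4 := ((measurePreserving_proj u).integrable_comp h3.aestronglyMeasurable).2 h3
  refine h4.congr (.of_forall fun t => ?_)
  simp only [Function.comp, energy, proj]
  rw [← Finset.prod_coe_sort u fun j => ψ j (t j) / gpdf (t j)]

/-- Integrability against the kernels follows from the inequality `ab ≤ a² w + b² / w`, where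
the two summands are products of integrable functions. -/
theorem abs_mul_prod_le (hA : Admissible ρ ψ) (hvu : v ⊆ u) (y t B : Fin d → ℝ) :
    |h (proj u (v.piecewise y t))| * ∏ j ∈ u \ v, (|B j| / gpdf (t j)) ≤
      energy ψ u h (v.piecewise y t) + (∏ j ∈ v, (gpdf (y j) / ψ j (y j))) *
        ∏ j ∈ u \ v, (B j ^ 2 / ψ j (t j) / gpdf (t j)) := by
  set x := v.piecewise y t with hx
  set W := ∏ j ∈ u, (ψ j (x j) / gpdf (x j)) with hW
  have hWpos : 0 < W := Finset.prod_pos fun j _ => div_pos (hA.weight_pos j _) (gpdf_pos _)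
  set a := |h (proj u x)|
  set b := ∏ j ∈ u \ v, (|B j| / gpdf (t j))
  have hb : b ^ 2 / W = (∏ j ∈ v, (gpdf (y j) / ψ j (y j))) *
        ∏ j ∈ u \ v, (B j ^ 2 / ψ j (t j) / gpdf (t j)) := by
    have hWs : W = (∏ j ∈ u \ v, (ψ j (t j) / gpdf (t j))) * ∏ j ∈ v, (ψ j (y j) / gpdf (y j)) := by
      rw [hW, ← Finset.prod_sdiff hvu]
      congr 1
      · refine Finset.prod_congr rfl fun j hj => ?_
        simp [hx, (Finset.mem_sdiff.1 hj).2]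
      · refine Finset.prod_congr rfl fun j hj => ?_
        simp [hx, hj]
    have h1 : (∏ j ∈ v, (gpdf (y j) / ψ j (y j))) = (∏ j ∈ v, (ψ j (y j) / gpdf (y j)))⁻¹ := by
      rw [← Finset.prod_inv_distrib]
      simp
    have hb2 : b ^ 2 = ∏ j ∈ u \ v, (|B j| / gpdf (t j)) ^ 2 := (Finset.prod_pow _ _ _).symm
    rw [hWs, h1, hb2, div_mul_eq_div_div, ← Finset.prod_div_distrib, div_eq_mul_inv, mul_comm]
    congr 1
    refine Finset.prod_congr rfl fun j _ => ?_
    have := (gpdf_pos (t j)).ne'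
    have := (hA.weight_pos j (t j)).ne'
    rw [div_pow, sq_abs]
    field_simp
  have hE : energy ψ u h x = a ^ 2 * W := by
    simp only [energy, a, sq_abs, hW]
  rw [hE, ← hb]
  have key : a * b = (a * W) * (b / W) := by field_simp
  have : a ^ 2 * W + b ^ 2 / W - 2 * (a * b) = (a * W - b) ^ 2 / W := by
    field_simp
    ring
  have h0 : 0 ≤ (a * W - b) ^ 2 / W := by positivity
  have h1 : 0 ≤ a * b := mul_nonneg (abs_nonneg _)
    (Finset.prod_nonneg fun j _ => div_nonneg (abs_nonneg _) (gpdf_pos _).le)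
  linarith

theorem integrable_prod_stepBound (hA : Admissible ρ ψ) (s : Finset (Fin d)) (R : ℝ) :
    Integrable (fun t : Fin d → ℝ => ∏ j ∈ s, (stepBound (ρ j) R (t j) ^ 2 / ψ j (t j) /
      gpdf (t j))) (gaussPi (Fin d)) := by
  have hf : ∀ j, Integrable (fun t => if j ∈ s then stepBound (ρ j) R t ^ 2 / ψ j t / gpdf t else 1)
      (ProbabilityTheory.gaussianReal 0 1) := fun j => by
    by_cases hj : j ∈ s
    · simp only [hj, if_true]
      rw [integrable_gauss_iff]
      refine (integrable_stepBound_sq_div (hA.pos j) (hA.integrable j) (hA.weight_pos j)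
        (hA.weight j).aestronglyMeasurable (hA.cond j) R).congr (.of_forall fun t => ?_)
      simp only
      rw [div_mul_cancel₀ _ (gpdf_pos _).ne']
    · simp [hj]
  refine (Integrable.fintype_prod hf).congr (.of_forall fun t => ?_)
  simp only
  rw [Finset.prod_ite_mem, Finset.univ_inter]

theorem integrableOn_prod_inv_weight (hA : Admissible ρ ψ) (s : Finset (Fin d)) (R : ℝ) :
    IntegrableOn (fun y : Fin d → ℝ => ∏ j ∈ s, (gpdf (y j) / ψ j (y j)))
      (Icc (fun _ => -R) fun _ => R) (gaussPi (Fin d)) := by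
  have hf : ∀ j, IntegrableOn (fun t => if j ∈ s then gpdf t / ψ j t else 1) (Icc (-R) R)
      (ProbabilityTheory.gaussianReal 0 1) := fun j => by
    by_cases hj : j ∈ s
    · simp only [hj, if_true]
      rw [← integrable_indicator_iff measurableSet_Icc, integrable_gauss_iff]
      have h1 := ((hA.inv_weight j).integrableOn_isCompact (isCompact_Icc (a := -R) (b := R)))
      have h2 := h1.mul_continuousOn ((continuous_gpdf.pow 2).continuousOn) isCompact_Icc
      rw [← integrable_indicator_iff measurableSet_Icc] at h2
      refine h2.congr (.of_forall fun t => ?_)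
      by_cases ht : t ∈ Icc (-R) R
      · simp only [indicator_of_mem ht, Pi.pow_apply]
        ring
      · simp [ht]
    · simp [hj]
  have := Integrable.fintype_prod hf
  rw [← Measure.restrict_pi_pi, pi_univ_Icc] at this
  refine Integrable.congr this (.of_forall fun t => ?_)
  simp only
  rw [Finset.prod_ite_mem, Finset.univ_inter]

theorem integrable_energy_piecewise (h2 : Integrable fun x => h x ^ 2 * psiProd ψ u x)
    (v : Finset (Fin d)) :
    Integrable (fun p : (Fin d → ℝ) × (Fin d → ℝ) => energy ψ u h (v.piecewise p.1 p.2))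
      ((gaussPi (Fin d)).prod (gaussPi (Fin d))) :=
  ((measurePreserving_piecewise v).integrable_comp
    (integrable_energy h2).aestronglyMeasurable).2 (integrable_energy h2)

theorem ae_integrable_energy (h2 : Integrable fun x => h x ^ 2 * psiProd ψ u x)
    (v : Finset (Fin d)) :
    ∀ᵐ y, Integrable (fun t => energy ψ u h (v.piecewise y t)) (gaussPi (Fin d)) := by
  rw [← ae_gaussPi]
  exact (integrable_energy_piecewise h2 v).prod_right_ae

theorem measurable_prod_stepKer (hA : Admissible ρ ψ) (s : Finset (Fin d)) :
    Measurable fun p : (Fin d → ℝ) × (Fin d → ℝ) =>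
      ∏ j ∈ s, (stepKer (ρ j) (p.1 j) (p.2 j) / gpdf (p.2 j)) := by
  refine Finset.measurable_fun_prod _ fun j _ => ?_
  have h2 : Measurable fun p : (Fin d → ℝ) × (Fin d → ℝ) => p.2 j := by fun_prop
  have h12 : Measurable fun p : (Fin d → ℝ) × (Fin d → ℝ) => (p.1 j, p.2 j) := by fun_prop
  exact ((measurable_stepKer (hA.pos j) (hA.integrable j)).comp h12).div (measurable_gpdf.comp h2)

theorem measurable_proj_piecewise (hm : Measurable h) (v : Finset (Fin d)) :
    Measurable fun p : (Fin d → ℝ) × (Fin d → ℝ) => h (proj u (v.piecewise p.1 p.2)) :=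
  hm.comp ((measurable_proj u).comp (measurable_piecewise v))

theorem measurable_potential_integrand (hA : Admissible ρ ψ) (hm : Measurable h)
    (v : Finset (Fin d)) :
    Measurable fun p : (Fin d → ℝ) × (Fin d → ℝ) => h (proj u (v.piecewise p.1 p.2)) *
      ∏ j ∈ u \ v, (stepKer (ρ j) (p.1 j) (p.2 j) / gpdf (p.2 j)) :=
  (measurable_proj_piecewise hm v).mul (measurable_prod_stepKer hA _)

theorem abs_prod_stepKer_le (hA : Admissible ρ ψ) (s : Finset (Fin d)) {R : ℝ}
    {y : Fin d → ℝ} (hy : ∀ j, |y j| ≤ R) (t : Fin d → ℝ) :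
    |∏ j ∈ s, (stepKer (ρ j) (y j) (t j) / gpdf (t j))| ≤
      ∏ j ∈ s, (|stepBound (ρ j) R (t j)| / gpdf (t j)) := by
  rw [Finset.abs_prod]
  refine Finset.prod_le_prod (fun j _ => abs_nonneg _) fun j _ => ?_
  rw [abs_div, abs_of_pos (gpdf_pos _)]
  refine div_le_div_of_nonneg_right ?_ (gpdf_pos (t j)).le
  exact (abs_stepKer_le (hA.pos j) (hA.integrable j) (hA.integral_eq_one j) (hy j) _).trans
    (le_abs_self _)

theorem abs_potential_integrand_le (hA : Admissible ρ ψ) (hvu : v ⊆ u) {R : ℝ}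
    {y : Fin d → ℝ} (hy : ∀ j, |y j| ≤ R) (y' t : Fin d → ℝ) :
    ‖h (proj u (v.piecewise y' t)) * ∏ j ∈ u \ v, (stepKer (ρ j) (y j) (t j) / gpdf (t j))‖ ≤
      energy ψ u h (v.piecewise y' t) + (∏ j ∈ v, (gpdf (y' j) / ψ j (y' j))) *
        ∏ j ∈ u \ v, (stepBound (ρ j) R (t j) ^ 2 / ψ j (t j) / gpdf (t j)) := by
  rw [norm_mul, Real.norm_eq_abs, Real.norm_eq_abs]
  refine le_trans ?_ (abs_mul_prod_le hA hvu y' t fun j => stepBound (ρ j) R (t j))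
  gcongr
  exact abs_prod_stepKer_le hA _ hy t

theorem exists_abs_le (y : Fin d → ℝ) : ∃ R, ∀ j, |y j| ≤ R :=
  ⟨‖y‖, fun j => norm_le_pi_norm y j⟩

theorem integrable_potential_integrand (hA : Admissible ρ ψ) (hm : Measurable h) (hvu : v ⊆ u)
    {y' : Fin d → ℝ}
    (hy' : Integrable (fun t => energy ψ u h (v.piecewise y' t)) (gaussPi (Fin d)))
    (y : Fin d → ℝ) :
    Integrable (fun t => h (proj u (v.piecewise y' t)) *
      ∏ j ∈ u \ v, (stepKer (ρ j) (y j) (t j) / gpdf (t j))) (gaussPi (Fin d)) := by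
  obtain ⟨R, hR⟩ := exists_abs_le y
  refine (hy'.add ((integrable_prod_stepBound hA (u \ v) R).const_mul
    (∏ j ∈ v, (gpdf (y' j) / ψ j (y' j))))).mono' ?_ (.of_forall fun t =>
      abs_potential_integrand_le hA hvu hR y' t)
  exact (((measurable_proj_piecewise hm v).comp (measurable_const.prodMk measurable_id)).mul
    ((measurable_prod_stepKer hA _).comp
      (measurable_const.prodMk measurable_id))).aestronglyMeasurable

theorem locallyIntegrable_potential (hA : Admissible ρ ψ) (hm : Measurable h)
    (h2 : Integrable fun x => h x ^ 2 * psiProd ψ u x) (hvu : v ⊆ u) :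
    LocallyIntegrable (potential ρ u h v) volume := by
  refine locallyIntegrable_of_gaussPi fun R => ?_
  set Q : Set (Fin d → ℝ) := Icc (fun _ => -R) fun _ => R
  have h3 : Integrable (fun p : (Fin d → ℝ) × (Fin d → ℝ) => energy ψ u h (v.piecewise p.1 p.2))
      (((gaussPi (Fin d)).restrict Q).prod (gaussPi (Fin d))) := by
    refine (integrable_energy_piecewise h2 v).mono_measure ?_
    exact Measure.prod_mono Measure.restrict_le_self le_rfl
  have h4 := Integrable.mul_prod (integrableOn_prod_inv_weight hA v R)
    (integrable_prod_stepBound hA (u \ v) R)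
  refine Integrable.integral_prod_left (f := fun p : (Fin d → ℝ) × (Fin d → ℝ) =>
    h (proj u (v.piecewise p.1 p.2)) *
      ∏ j ∈ u \ v, (stepKer (ρ j) (p.1 j) (p.2 j) / gpdf (p.2 j))) ?_
  refine (h3.add h4).mono' (measurable_potential_integrand hA hm v).aestronglyMeasurable ?_
  have hQ : ∀ᵐ p ∂(((gaussPi (Fin d)).restrict Q).prod (gaussPi (Fin d))), p.1 ∈ Q :=
    Measure.quasiMeasurePreserving_fst.ae (ae_restrict_mem measurableSet_Icc)
  filter_upwards [hQ] with p hp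
  exact abs_potential_integrand_le hA hvu (fun j => abs_le.2 ⟨hp.1 j, hp.2 j⟩) p.1 p.2

/-- The increment of the potential in a variable `i ∈ u∖v` is an integral of the potential with
`i` added to `v`, because that of the kernel is the indicator function of an interval. -/
theorem potential_increment (hA : Admissible ρ ψ) (hm : Measurable h) (hvu : v ⊆ u)
    {i : Fin d} (hiu : i ∈ u) (hiv : i ∉ v) {y : Fin d → ℝ}
    (hy : Integrable (fun t => energy ψ u h (v.piecewise y t)) (gaussPi (Fin d)))
    {l : ℝ} (hl : 0 < l) :
    potential ρ u h v (y + l • Pi.single i 1) - potential ρ u h v y =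
      ∫ s in (0:ℝ)..l, potential ρ u h (insert i v) (y + s • Pi.single i 1) := by
  have hupd : ∀ s : ℝ, y + s • (Pi.single i 1 : Fin d → ℝ) = Function.update y i (y i + s) := by
    intro s
    funext j
    by_cases hj : j = i
    · subst hj; simp
    · simp [hj]
  have hpw : ∀ (s : ℝ) t, v.piecewise (Function.update y i s) t = v.piecewise y t := by
    intro s t
    funext j
    by_cases hj : j ∈ v
    · have : j ≠ i := fun h => hiv (h ▸ hj)
      simp [hj, this]
    · simp [hj]
  have hins : insert i (u \ insert i v) = u \ v := by
    ext j
    by_cases hj : j = i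
    · subst hj; simp [hiu, hiv]
    · simp [hj]
  have hnot : i ∉ u \ insert i v := by simp
  have hprod : ∀ (s : ℝ) (t : Fin d → ℝ),
      ∏ j ∈ u \ v, (stepKer (ρ j) (Function.update y i s j) (t j) / gpdf (t j)) =
      (stepKer (ρ i) s (t i) / gpdf (t i)) *
        ∏ j ∈ u \ insert i v, (stepKer (ρ j) (y j) (t j) / gpdf (t j)) := by
    intro s t
    rw [← hins, Finset.prod_insert hnot]
    congr 1
    · simp
    · refine Finset.prod_congr rfl fun j hj => ?_
      have : j ≠ i := fun h => hnot (h ▸ hj)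
      simp [this]
  set F : (Fin d → ℝ) → ℝ := fun t => h (proj u (v.piecewise y t)) *
    (((Ioc (y i) (y i + l)).indicator 1 (t i) / gpdf (t i)) *
      ∏ j ∈ u \ insert i v, (stepKer (ρ j) (y j) (t j) / gpdf (t j))) with hF
  have hFsub : ∀ t, h (proj u (v.piecewise y t)) * ∏ j ∈ u \ v,
        (stepKer (ρ j) (Function.update y i (y i + l) j) (t j) / gpdf (t j)) -
      h (proj u (v.piecewise y t)) * ∏ j ∈ u \ v,
        (stepKer (ρ j) (Function.update y i (y i) j) (t j) / gpdf (t j)) = F t := by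
    intro t
    rw [hprod, hprod, hF]
    simp only
    rw [← stepKer_add_sub (ρ i) _ _ hl.le]
    ring
  have hI1 := integrable_potential_integrand hA hm hvu hy (Function.update y i (y i + l))
  have hI2 := integrable_potential_integrand hA hm hvu hy (Function.update y i (y i))
  have hFi : Integrable F (gaussPi (Fin d)) := (hI1.sub hI2).congr (.of_forall fun t => hFsub t)
  have hmp := measurePreserving_update i
  have hFu : Integrable (fun p : ℝ × (Fin d → ℝ) => F (Function.update p.2 i p.1))
      ((ProbabilityTheory.gaussianReal 0 1).prod (gaussPi (Fin d))) :=
    (hmp.integrable_comp hFi.aestronglyMeasurable).2 hFi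
  have e1 : potential ρ u h v (y + l • Pi.single i 1) - potential ρ u h v y =
      ∫ t, F t ∂(gaussPi (Fin d)) := by
    have h1 : potential ρ u h v y = ∫ t, h (proj u (v.piecewise y t)) * ∏ j ∈ u \ v,
        (stepKer (ρ j) (Function.update y i (y i) j) (t j) / gpdf (t j)) ∂(gaussPi (Fin d)) := by
      rw [Function.update_eq_self]
      rfl
    rw [hupd, h1, potential]
    simp_rw [hpw]
    rw [← integral_sub hI1 hI2]
    exact integral_congr_ae (.of_forall hFsub)
  -- integrate over `t_i` separately: it takes the place of `y_i` in the argument of `h`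
  have e2 : ∫ t, F t ∂(gaussPi (Fin d)) =
      ∫ s, (potential ρ u h (insert i v) (Function.update y i s) *
        ((Ioc (y i) (y i + l)).indicator 1 s / gpdf s))
        ∂(ProbabilityTheory.gaussianReal 0 1) := by
    rw [← hmp.map_eq, integral_map hmp.measurable.aemeasurable
      (by rw [hmp.map_eq]; exact hFi.aestronglyMeasurable), integral_prod _ hFu]
    refine integral_congr_ae (.of_forall fun s => ?_)
    simp only
    rw [potential, ← integral_mul_const]
    refine integral_congr_ae (.of_forall fun t => ?_)
    have hp : v.piecewise y (Function.update t i s) =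
        (insert i v).piecewise (Function.update y i s) t := by
      funext j
      by_cases hj : j = i
      · subst hj; simp [hiv]
      · by_cases hjv : j ∈ v <;> simp [hj, hjv]
    have hq : ∏ j ∈ u \ insert i v, (stepKer (ρ j) (y j) (Function.update t i s j) /
          gpdf (Function.update t i s j)) =
        ∏ j ∈ u \ insert i v, (stepKer (ρ j) (Function.update y i s j) (t j) / gpdf (t j)) := by
      refine Finset.prod_congr rfl fun j hj => ?_
      have : j ≠ i := fun h => hnot (h ▸ hj)
      simp [this]
    simp only [hF]
    rw [hp, hq, Function.update_self]
    ring
  have e3 : ∀ s, potential ρ u h (insert i v) (Function.update y i s) *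
        ((Ioc (y i) (y i + l)).indicator 1 s / gpdf s) * gpdf s =
      (Ioc (y i) (y i + l)).indicator
        (fun s => potential ρ u h (insert i v) (Function.update y i s)) s := by
    intro s
    have := (gpdf_pos s).ne'
    by_cases hs : s ∈ Ioc (y i) (y i + l)
    · simp only [indicator_of_mem hs, Pi.one_apply]
      field_simp
    · simp [hs]
  rw [e1, e2, integral_gauss]
  simp_rw [e3]
  rw [integral_indicator measurableSet_Ioc, ← intervalIntegral.integral_of_le (by linarith)]
  simp_rw [hupd]
  rw [intervalIntegral.integral_comp_add_left
    (fun s => potential ρ u h (insert i v) (Function.update y i s)) (y i), add_zero]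

theorem hasWeakDeriv_potential_insert (hA : Admissible ρ ψ) (hm : Measurable h)
    (h2 : Integrable fun x => h x ^ 2 * psiProd ψ u x) (hvu : v ⊆ u)
    {i : Fin d} (hiu : i ∈ u) (hiv : i ∉ v) :
    HasWeakDeriv {i} (potential ρ u h v) (potential ρ u h (insert i v)) := by
  refine hasWeakDeriv_of_increment (locallyIntegrable_potential hA hm h2 hvu)
    (locallyIntegrable_potential hA hm h2 (Finset.insert_subset hiu hvu)) i fun l hl => ?_
  filter_upwards [ae_integrable_energy h2 v] with y hy
  exact potential_increment hA hm hvu hiu hiv hy hl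

theorem hasWeakDeriv_potential_zero (hA : Admissible ρ ψ) (hm : Measurable h)
    (h2 : Integrable fun x => h x ^ 2 * psiProd ψ u x) {i : Fin d} (hiu : i ∉ u) :
    HasWeakDeriv {i} (potential ρ u h ∅) 0 := by
  refine hasWeakDeriv_of_increment (locallyIntegrable_potential hA hm h2 (Finset.empty_subset u))
    locallyIntegrable_zero i fun l _ => .of_forall fun y => ?_
  simp only [intervalIntegral.integral_zero, sub_eq_zero, potential,
    Finset.sdiff_empty, Finset.piecewise_empty]
  refine integral_congr_ae (.of_forall fun t => ?_)
  simp only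
  congr 1
  refine Finset.prod_congr rfl fun j hj => ?_
  have : j ≠ i := fun h => hiu (h ▸ hj)
  simp [this]

theorem hasWeakDeriv_potential (hA : Admissible ρ ψ) (hm : Measurable h)
    (h2 : Integrable fun x => h x ^ 2 * psiProd ψ u x) :
    ∀ v ⊆ u, HasWeakDeriv v (potential ρ u h ∅) (potential ρ u h v) := by
  intro v
  induction v using Finset.induction_on with
  | empty => exact fun hu => .refl (locallyIntegrable_potential hA hm h2 hu)
  | insert i v hi ih =>
    intro hu
    obtain ⟨hiu, hvu⟩ := Finset.insert_subset_iff.1 hu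
    have := (ih hvu).trans (Finset.disjoint_singleton_right.2 hi)
      (hasWeakDeriv_potential_insert hA hm h2 hvu hiu hi)
    rwa [Finset.union_comm, ← Finset.insert_eq] at this

theorem hasWeakDeriv_zero (v : Finset (Fin d)) : HasWeakDeriv v (0 : (Fin d → ℝ) → ℝ) 0 :=
  ⟨locallyIntegrable_zero, locallyIntegrable_zero, by simp⟩

theorem hasWeakDeriv_potential_of_not_subset (hA : Admissible ρ ψ) (hm : Measurable h)
    (h2 : Integrable fun x => h x ^ 2 * psiProd ψ u x) (hvu : ¬ v ⊆ u) :
    HasWeakDeriv v (potential ρ u h ∅) 0 := by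
  obtain ⟨i, hiv, hiu⟩ := Finset.not_subset.1 hvu
  have := (hasWeakDeriv_potential_zero hA hm h2 hiu).trans
    (Finset.disjoint_singleton_left.2 (Finset.notMem_erase i v)) (hasWeakDeriv_zero (v.erase i))
  rwa [← Finset.insert_eq, Finset.insert_erase hiv] at this

end

section

variable {ρ ψ : Fin d → ℝ → ℝ} {u v : Finset (Fin d)} {h : ({j // j ∈ u} → ℝ) → ℝ}

/-! ### Averages and continuity of potentials -/

theorem prod_sdiff_eq_prod_subtype (u v : Finset (Fin d)) (F : Fin d → ℝ) :
    ∏ j ∈ u \ v, F j = ∏ j : {j // j ∉ v}, if j.1 ∈ u then F j else 1 := by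
  rw [← Finset.prod_subtype vᶜ (by simp) fun j => if j ∈ u then F j else 1, Finset.prod_ite_mem]
  congr 1
  ext j
  simp [and_comm]

/-- The absolute moments `∫ |Φ(t) - 1_{t > y}| ρ(y) dy = 2 Φ(t) (1 - Φ(t))` of the kernels are
controlled by `stepBound`, which makes the potential integrable against the densities. -/
theorem integrable_mul_prod_moment (hA : Admissible ρ ψ) (hm : Measurable h) (hvu : v ⊆ u)
    {y : Fin d → ℝ}
    (hy : Integrable (fun t => energy ψ u h (v.piecewise y t)) (gaussPi (Fin d))) :
    Integrable (fun t => |h (proj u (v.piecewise y t))| * ∏ j ∈ u \ v,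
      (2 * (distFun (ρ j) (t j) * (1 - distFun (ρ j) (t j))) / gpdf (t j)))
      (gaussPi (Fin d)) := by
  refine ((hy.add ((integrable_prod_stepBound hA (u \ v) 0).const_mul
    (∏ j ∈ v, (gpdf (y j) / ψ j (y j))))).const_mul (2 ^ (u \ v).card)).mono' ?_
      (.of_forall fun t => ?_)
  · refine Measurable.aestronglyMeasurable ?_
    refine Measurable.mul (continuous_abs.measurable.comp
      ((measurable_proj_piecewise hm v).comp (measurable_const.prodMk measurable_id))) ?_
    refine Finset.measurable_fun_prod _ fun j _ => ?_
    have hΦ : Measurable fun t : Fin d → ℝ => distFun (ρ j) (t j) :=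
      (measurable_distFun (hA.pos j) (hA.integrable j)).comp (measurable_pi_apply j)
    exact ((hΦ.mul (hΦ.const_sub 1)).const_mul 2).div (measurable_gpdf.comp (measurable_pi_apply j))
  · have hΦ : ∀ j, 0 ≤ distFun (ρ j) (t j) * (1 - distFun (ρ j) (t j)) := fun j =>
      mul_nonneg (distFun_nonneg (hA.pos j) _) (sub_nonneg.2
        (distFun_le_one (hA.pos j) (hA.integrable j) (hA.integral_eq_one j) _))
    rw [norm_mul, Real.norm_eq_abs, abs_abs, Real.norm_of_nonneg
      (Finset.prod_nonneg fun j _ => div_nonneg (mul_nonneg zero_le_two (hΦ j)) (gpdf_pos _).le)]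
    refine le_trans ?_ (mul_le_mul_of_nonneg_left
      (abs_mul_prod_le hA hvu y t fun j => stepBound (ρ j) 0 (t j)) (by positivity))
    rw [mul_left_comm]
    refine mul_le_mul_of_nonneg_left ?_ (abs_nonneg _)
    rw [← Finset.prod_const, ← Finset.prod_mul_distrib]
    refine Finset.prod_le_prod
      (fun j _ => div_nonneg (mul_nonneg zero_le_two (hΦ j)) (gpdf_pos _).le) fun j _ => ?_
    rw [mul_div_assoc]
    refine mul_le_mul_of_nonneg_left (div_le_div_of_nonneg_right ?_ (gpdf_pos _).le) zero_le_two
    exact (distFun_mul_le_stepBound (hA.pos j) (hA.integrable j) (hA.integral_eq_one j) _).trans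
      (le_abs_self _)

/-- The averages over the variables outside `v` of the derivative `∂^v` of the component in `u`:
for `v ≠ u` the mean-zero property of the kernel in a variable `j ∈ u∖v` makes them vanish. -/
theorem innerInt_potential_aux (hA : Admissible ρ ψ) (hm : Measurable h) (hvu : v ⊆ u)
    (xv : {j // j ∈ v} → ℝ)
    (hx : Integrable (fun t => energy ψ u h (v.piecewise (glue v xv 0) t)) (gaussPi (Fin d))) :
    Integrable (fun z => potential ρ u h v (glue v xv z) * rhoCompl ρ v z) ∧
      (v ≠ u → innerInt ρ v (potential ρ u h v) xv = 0) := by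
  -- the variables of `y` outside `v` do not matter
  set y := glue v xv 0 with hy
  set κ : {j // j ∉ v} → ℝ → ℝ → ℝ := fun j a b =>
    (if j.1 ∈ u then stepKer (ρ j) a b / gpdf b else 1) * ρ j a with hκ
  set J : ({j // j ∉ v} → ℝ) × (Fin d → ℝ) → ℝ := fun p =>
    h (proj u (v.piecewise y p.2)) * ∏ j, κ j (p.1 j) (p.2 j) with hJ
  have hpot : ∀ z, potential ρ u h v (glue v xv z) * rhoCompl ρ v z =
      ∫ t, J (z, t) ∂(gaussPi (Fin d)) := by
    intro z
    rw [potential, ← integral_mul_const]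
    refine integral_congr_ae (.of_forall fun t => ?_)
    have hpw : v.piecewise (glue v xv z) t = v.piecewise y t := by
      funext j
      by_cases hj : j ∈ v <;> simp [hj, hy, glue]
    simp only [hJ, hκ, rhoCompl]
    rw [hpw, mul_assoc, prod_sdiff_eq_prod_subtype, ← Finset.prod_mul_distrib]
    congr 1
    refine Finset.prod_congr rfl fun j _ => ?_
    simp [glue, j.2]
  have hκint : ∀ j b, Integrable (fun a => κ j a b) := fun j b => by
    by_cases hj : j.1 ∈ u
    · simp only [hκ, hj, if_true]
      refine ((integrable_stepKer_mul (hA.integrable j) b).div_const (gpdf b)).congr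
        (.of_forall fun a => ?_)
      simp only
      ring
    · simpa [hκ, hj] using hA.integrable j
  have hκnorm : ∀ j b, ∫ a, ‖κ j a b‖ =
      if j.1 ∈ u then 2 * (distFun (ρ j) b * (1 - distFun (ρ j) b)) / gpdf b else 1 := fun j b => by
    by_cases hj : j.1 ∈ u
    · simp only [hκ, hj, if_true]
      rw [← integral_abs_stepKer_mul (hA.pos j) (hA.integrable j) (hA.integral_eq_one j),
        ← integral_div]
      refine integral_congr_ae (.of_forall fun a => ?_)
      simp only
      rw [Real.norm_eq_abs, abs_mul, abs_div, abs_of_pos (gpdf_pos b), abs_of_pos (hA.pos j a)]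
      ring
    · simp only [hκ, hj, if_false, one_mul]
      rw [← hA.integral_eq_one j]
      exact integral_congr_ae (.of_forall fun a => Real.norm_of_nonneg (hA.pos j a).le)
  have hJm : AEStronglyMeasurable J (volume.prod (gaussPi (Fin d))) := by
    refine AEStronglyMeasurable.mul ?_ ?_
    · exact (((measurable_proj_piecewise hm v).comp
        (measurable_const.prodMk measurable_id)).comp measurable_snd).aestronglyMeasurable
    · refine Finset.aestronglyMeasurable_fun_prod _ fun j _ => ?_
      refine AEStronglyMeasurable.mul ?_ ?_
      · refine Measurable.aestronglyMeasurable ?_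
        by_cases hj : j.1 ∈ u
        · simp only [hj, if_true]
          have h1 : Measurable fun p : ({j // j ∉ v} → ℝ) × (Fin d → ℝ) => (p.1 j, p.2 j) := by
            fun_prop
          have h2 : Measurable fun p : ({j // j ∉ v} → ℝ) × (Fin d → ℝ) => p.2 j := by fun_prop
          exact ((measurable_stepKer (hA.pos j) (hA.integrable j)).comp h1).div
            (measurable_gpdf.comp h2)
        · simp [hj]
      · exact ((hA.integrable j).aestronglyMeasurable.comp_quasiMeasurePreserving
          (Measure.quasiMeasurePreserving_eval
            (fun _ : {j // j ∉ v} => (volume : Measure ℝ)) j)).comp_fst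
  have hJi : Integrable J (volume.prod (gaussPi (Fin d))) := by
    rw [integrable_prod_iff' hJm]
    constructor
    · refine .of_forall fun t => ?_
      have h1 : Integrable (fun z : {j // j ∉ v} → ℝ => ∏ j, κ j (z j) (t j)) volume :=
        Integrable.fintype_prod fun j => hκint j (t j)
      exact h1.const_mul (h (proj u (v.piecewise y t)))
    · refine (integrable_mul_prod_moment hA hm hvu hx).congr (.of_forall fun t => ?_)
      simp only [hJ, norm_mul, norm_prod]
      rw [integral_const_mul, integral_fintype_prod_volume_eq_prod
        (fun j : {j // j ∉ v} => fun a => ‖κ j a (t j)‖), prod_sdiff_eq_prod_subtype]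
      simp_rw [hκnorm]
      rfl
  refine ⟨hJi.integral_prod_left.congr (.of_forall fun z => (hpot z).symm), fun hne => ?_⟩
  obtain ⟨i, hiu, hiv⟩ := Finset.not_subset.1 fun hs => hne (hvu.antisymm hs)
  have hz : ∀ t, ∫ z, J (z, t) = 0 := fun t => by
    simp only [hJ]
    rw [integral_const_mul, integral_fintype_prod_volume_eq_prod
      (fun j : {j // j ∉ v} => fun a => κ j a (t j)),
      Finset.prod_eq_zero (Finset.mem_univ (⟨i, hiv⟩ : {j // j ∉ v})), mul_zero]
    simp only [hκ, hiu, if_true]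
    have : ∀ a, stepKer (ρ i) a (t i) / gpdf (t i) * ρ i a =
        stepKer (ρ i) a (t i) * ρ i a / gpdf (t i) := fun a => by ring
    simp_rw [this]
    rw [integral_div, integral_stepKer_mul (hA.integrable i) (hA.integral_eq_one i), zero_div]
  simp only [innerInt, hpot]
  rw [integral_integral_swap hJi]
  simp [hz]

theorem potential_self (y : Fin d → ℝ) : potential ρ u h u y = h (proj u y) := by
  have : ∀ t, proj u (u.piecewise y t) = proj u y := fun t => by
    funext j
    simp [proj]
  simp [potential, this]

theorem potential_self_glue (x : {j // j ∈ u} → ℝ) (z : {j // j ∉ u} → ℝ) :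
    potential ρ u h u (glue u x z) = h x := by
  rw [potential_self, proj_glue]

theorem innerInt_potential_self (hA : Admissible ρ ψ) (x : {j // j ∈ u} → ℝ) :
    innerInt ρ u (potential ρ u h u) x = h x := by
  simp only [innerInt, potential_self_glue]
  rw [integral_const_mul, integral_rhoCompl hA.integral_eq_one, mul_one]

/-- The component with `P_u f = h` lies in the ANOVA space, and its other averages vanish. -/
theorem exists_weakDeriv_potential (hA : Admissible ρ ψ) (hm : Measurable h)
    (h2 : Integrable fun x => h x ^ 2 * psiProd ψ u x) (v : Finset (Fin d)) :
    ∃ g, HasWeakDeriv v (potential ρ u h ∅) g ∧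
      (∀ᵐ xv, Integrable fun z => g (glue v xv z) * rhoCompl ρ v z) ∧
      (v ≠ u → innerInt ρ v g =ᵐ[volume] 0) ∧
      (∀ hvu : v = u, ∀ xv, innerInt ρ v g xv = h (fun j => xv ⟨j, hvu ▸ j.2⟩)) := by
  by_cases hvu : v ⊆ u
  · refine ⟨_, hasWeakDeriv_potential hA hm h2 v hvu, ?_⟩
    have hae : ∀ᵐ xv, Integrable (fun t => energy ψ u h (v.piecewise (glue v xv 0) t))
        (gaussPi (Fin d)) := by
      refine ae_of_ae_proj ?_
      filter_upwards [ae_integrable_energy h2 v] with y hy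
      have hpw : ∀ t, v.piecewise (glue v (proj v y) 0) t = v.piecewise y t := fun t => by
        funext j
        by_cases hj : j ∈ v <;> simp [hj, glue, proj]
      simpa only [hpw] using hy
    refine ⟨?_, ?_, ?_⟩
    · filter_upwards [hae] with xv hx
      exact (innerInt_potential_aux hA hm hvu xv hx).1
    · intro hne
      filter_upwards [hae] with xv hx
      exact (innerInt_potential_aux hA hm hvu xv hx).2 hne
    · rintro rfl xv
      exact innerInt_potential_self hA xv
  · refine ⟨0, hasWeakDeriv_potential_of_not_subset hA hm h2 hvu, by simp, ?_, ?_⟩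
    · intro _
      exact .of_forall fun xv => by simp [innerInt]
    · rintro rfl
      exact absurd subset_rfl hvu

theorem memAnova_potential (hA : Admissible ρ ψ) (hm : Measurable h)
    (h2 : Integrable fun x => h x ^ 2 * psiProd ψ u x) : MemAnova ρ ψ (potential ρ u h ∅) := by
  refine ⟨locallyIntegrable_potential hA hm h2 (Finset.empty_subset u), fun v => ?_⟩
  obtain ⟨g, hg, hi, h0, h1⟩ := exists_weakDeriv_potential hA hm h2 v
  refine ⟨g, hg, hi, ?_⟩
  by_cases hvu : v = u
  · subst hvu
    simpa only [h1 rfl] using h2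
  · refine (integrable_zero _ ℝ _).congr ?_
    filter_upwards [h0 hvu] with x hx
    simp [hx]

theorem continuous_potential (hA : Admissible ρ ψ) (hm : Measurable h)
    (h2 : Integrable fun x => h x ^ 2 * psiProd ψ u x) : Continuous (potential ρ u h ∅) := by
  refine continuous_iff_continuousAt.2 fun y => ?_
  have hE := integrable_energy h2
  have hR : ∀ᶠ y' in nhds y, ∀ j, |y' j| ≤ ‖y‖ + 1 := by
    filter_upwards [Metric.ball_mem_nhds y one_pos] with y' hy' j
    have h1 : ‖y'‖ ≤ ‖y‖ + ‖y' - y‖ := by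
      simpa using norm_add_le y (y' - y)
    rw [Metric.mem_ball, dist_eq_norm] at hy'
    exact (norm_le_pi_norm y' j).trans (by linarith)
  refine continuousAt_of_dominated (bound := fun t => energy ψ u h t +
      ∏ j ∈ u \ ∅, (stepBound (ρ j) (‖y‖ + 1) (t j) ^ 2 / ψ j (t j) / gpdf (t j)))
    (.of_forall fun y' => ?_) ?_ (hE.add (integrable_prod_stepBound hA _ _)) ?_
  · exact ((measurable_potential_integrand hA hm ∅).comp
      (measurable_const.prodMk measurable_id)).aestronglyMeasurable
  · filter_upwards [hR] with y' hy'
    refine .of_forall fun t => ?_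
    simpa using abs_potential_integrand_le (h := h) hA (Finset.empty_subset u) hy' y' t
  -- the integrand is continuous at `y` unless `t` lies on one of the hyperplanes `t_j = y_j`
  · have hne : ∀ᵐ t ∂(gaussPi (Fin d)), ∀ j, t j ≠ y j := by
      rw [ae_gaussPi, ae_all_iff]
      intro j
      have : ∀ᵐ s : ℝ, s ≠ y j := by simp [ae_iff]
      exact (Measure.quasiMeasurePreserving_eval (fun _ : Fin d => (volume : Measure ℝ)) j).ae this
    filter_upwards [hne] with t ht
    simp only [Finset.piecewise_empty]
    refine continuousAt_const.mul ?_
    refine tendsto_finsetProd _ fun j _ => ?_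
    have h1 : ContinuousAt (fun y' : Fin d → ℝ => stepKer (ρ j) (y' j) (t j)) y :=
      (continuousAt_stepKer (ρ j) (ht j)).comp (f := fun y' : Fin d → ℝ => y' j)
        (continuous_apply j).continuousAt
    exact h1.div_const _

/-- The component in `u` as a Lebesgue integral over `ℝ^u`. -/
theorem potential_empty_eq (ρ : Fin d → ℝ → ℝ) (u : Finset (Fin d))
    (h : ({j // j ∈ u} → ℝ) → ℝ) (hm : Measurable h)
    (hρm : ∀ j (y : ℝ), Measurable fun t => stepKer (ρ j) y t) (y : Fin d → ℝ) :
    potential ρ u h ∅ y =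
      ∫ x : {j // j ∈ u} → ℝ, h x * ∏ j : {j // j ∈ u}, stepKer (ρ j) (y j) (x j) := by
  have hm' : Measurable fun x : {j // j ∈ u} → ℝ =>
      h x * ∏ j : {j // j ∈ u}, (stepKer (ρ j) (y j) (x j) / gpdf (x j)) := by
    refine hm.mul (Finset.measurable_fun_prod _ fun j _ => ?_)
    exact ((hρm j (y j)).comp (measurable_pi_apply j)).div
      (measurable_gpdf.comp (measurable_pi_apply j))
  have h1 : potential ρ u h ∅ y = ∫ x, h x *
      ∏ j : {j // j ∈ u}, (stepKer (ρ j) (y j) (x j) / gpdf (x j)) ∂(gaussPi {j // j ∈ u}) := by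
    rw [← (measurePreserving_proj u).map_eq, integral_map (measurable_proj u).aemeasurable
      hm'.aestronglyMeasurable]
    simp only [potential, Finset.piecewise_empty, Finset.sdiff_empty]
    refine integral_congr_ae (.of_forall fun t => ?_)
    simp only [proj]
    rw [← Finset.prod_coe_sort u fun j => stepKer (ρ j) (y j) (t j) / gpdf (t j)]
  rw [h1, integral_gaussPi]
  refine integral_congr_ae (.of_forall fun x => ?_)
  simp only
  rw [mul_assoc, ← Finset.prod_mul_distrib]
  congr 1
  refine Finset.prod_congr rfl fun j _ => ?_
  rw [div_mul_cancel₀ _ (gpdf_pos _).ne']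

end

variable {ρ ψ : Fin d → ℝ → ℝ} {γ : Finset (Fin d) → ℝ}

/-! ### The averages of weak derivatives as square integrable functions -/

/-- The function `P_u f` of the variables in `u`. -/
def avg (ρ : Fin d → ℝ → ℝ) (u : Finset (Fin d)) (f : (Fin d → ℝ) → ℝ) :
    ({j // j ∈ u} → ℝ) → ℝ :=
  innerInt ρ u (weakDeriv u f)

theorem innerInt_ae_eq (ρ : Fin d → ℝ → ℝ) (u : Finset (Fin d)) {g g' : (Fin d → ℝ) → ℝ}
    (h : g =ᵐ[volume] g') : innerInt ρ u g =ᵐ[volume] innerInt ρ u g' := by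
  filter_upwards [innerInt_congr_ae ρ u h] with xu hx
  exact integral_congr_ae hx

theorem avg_ae_eq {u : Finset (Fin d)} {f g : (Fin d → ℝ) → ℝ} (h : HasWeakDeriv u f g) :
    avg ρ u f =ᵐ[volume] innerInt ρ u g :=
  innerInt_ae_eq ρ u (weakDeriv_ae_eq h)

theorem MemAnova.weakDeriv_spec {f : (Fin d → ℝ) → ℝ} (hf : MemAnova ρ ψ f)
    (u : Finset (Fin d)) : HasWeakDeriv u f (weakDeriv u f) ∧
      (∀ᵐ xu, Integrable fun z => weakDeriv u f (glue u xu z) * rhoCompl ρ u z) ∧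
      Integrable fun xu => avg ρ u f xu ^ 2 * psiProd ψ u xu := by
  obtain ⟨g, hg, hi, h2⟩ := hf.2 u
  have he := weakDeriv_ae_eq hg
  refine ⟨hasWeakDeriv_weakDeriv hg, ?_, h2.congr ?_⟩
  · filter_upwards [hi, innerInt_congr_ae ρ u he] with xu h1 h3
    exact h1.congr h3.symm
  · filter_upwards [innerInt_ae_eq ρ u he] with xu h1
    simp only [avg, h1]

theorem MemAnova.avg_congr {f f' : (Fin d → ℝ) → ℝ} (hf : MemAnova ρ ψ f)
    (h : f =ᵐ[volume] f') (u : Finset (Fin d)) : avg ρ u f =ᵐ[volume] avg ρ u f' :=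
  (avg_ae_eq ((hf.weakDeriv_spec u).1.congr h)).symm

theorem MemAnova.avg_add {f g : (Fin d → ℝ) → ℝ} (hf : MemAnova ρ ψ f) (hg : MemAnova ρ ψ g)
    (u : Finset (Fin d)) : avg ρ u (f + g) =ᵐ[volume] avg ρ u f + avg ρ u g := by
  obtain ⟨h1, i1, -⟩ := hf.weakDeriv_spec u
  obtain ⟨h2, i2, -⟩ := hg.weakDeriv_spec u
  refine (avg_ae_eq (h1.add h2)).trans ?_
  filter_upwards [i1, i2] with xu hx1 hx2
  simp only [innerInt, avg, Pi.add_apply, add_mul]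
  exact integral_add hx1 hx2

theorem MemAnova.avg_smul {f : (Fin d → ℝ) → ℝ} (hf : MemAnova ρ ψ f) (c : ℝ)
    (u : Finset (Fin d)) : avg ρ u (c • f) =ᵐ[volume] c • avg ρ u f := by
  obtain ⟨h1, -, -⟩ := hf.weakDeriv_spec u
  refine (avg_ae_eq (h1.smul c)).trans (.of_forall fun xu => ?_)
  simp only [innerInt, avg, Pi.smul_apply, smul_eq_mul, mul_assoc, integral_const_mul]

theorem anovaInner_congr {f f' g g' : (Fin d → ℝ) → ℝ} (hf : MemAnova ρ ψ f)
    (hg : MemAnova ρ ψ g) (hff : f =ᵐ[volume] f') (hgg : g =ᵐ[volume] g') :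
    anovaInner ρ ψ γ f g = anovaInner ρ ψ γ f' g' := by
  refine Finset.sum_congr rfl fun u _ => ?_
  congr 1
  refine integral_congr_ae ?_
  filter_upwards [hf.avg_congr hff u, hg.avg_congr hgg u] with xu h1 h2
  simp only [avg] at h1 h2
  rw [h1, h2]

/-- The measure `ψ_u / γ_u dx_u` on `ℝ^u`. -/
def weightMeasure (ψ : Fin d → ℝ → ℝ) (γ : Finset (Fin d) → ℝ) (u : Finset (Fin d)) :
    Measure ({j // j ∈ u} → ℝ) :=
  volume.withDensity fun x => ENNReal.ofReal (psiProd ψ u x / γ u)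

/-- The Hilbert sum of the spaces `L²(ψ_u / γ_u dx_u)`, which is the model for the ANOVA space. -/
abbrev Model (ψ : Fin d → ℝ → ℝ) (γ : Finset (Fin d) → ℝ) : Type :=
  PiLp 2 fun u : Finset (Fin d) => Lp ℝ 2 (weightMeasure ψ γ u)

theorem psiProd_pos (hA : Admissible ρ ψ) (u : Finset (Fin d)) (x : {j // j ∈ u} → ℝ) :
    0 < psiProd ψ u x :=
  Finset.prod_pos fun j _ => hA.weight_pos j _

theorem aemeasurable_weight (hA : Admissible ρ ψ) (u : Finset (Fin d)) :
    AEMeasurable (fun x => ENNReal.ofReal (psiProd ψ u x / γ u)) volume :=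
  ((aestronglyMeasurable_psiProd (fun j => (hA.weight j).aestronglyMeasurable) u).aemeasurable
    |>.div_const _).ennreal_ofReal

theorem weightMeasure_ac (u : Finset (Fin d)) : weightMeasure ψ γ u ≪ volume :=
  withDensity_absolutelyContinuous _ _

theorem ac_weightMeasure (hA : Admissible ρ ψ) (hγ : ∀ u, 0 < γ u) (u : Finset (Fin d)) :
    volume ≪ weightMeasure ψ γ u :=
  withDensity_absolutelyContinuous' (aemeasurable_weight hA u) (.of_forall fun x => by
    simp [div_pos (psiProd_pos hA u x) (hγ u)])

theorem integral_weightMeasure (hA : Admissible ρ ψ) (hγ : ∀ u, 0 < γ u) (u : Finset (Fin d))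
    (f : ({j // j ∈ u} → ℝ) → ℝ) :
    ∫ x, f x ∂(weightMeasure ψ γ u) = 1 / γ u * ∫ x, f x * psiProd ψ u x := by
  rw [weightMeasure, integral_withDensity_eq_integral_toReal_smul₀ (aemeasurable_weight hA u)
    (.of_forall fun _ => by simp), ← integral_const_mul]
  refine integral_congr_ae (.of_forall fun x => ?_)
  simp only [smul_eq_mul]
  rw [ENNReal.toReal_ofReal (div_pos (psiProd_pos hA u x) (hγ u)).le]
  ring

theorem memLp_weightMeasure_iff (hA : Admissible ρ ψ) (hγ : ∀ u, 0 < γ u) (u : Finset (Fin d))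
    {f : ({j // j ∈ u} → ℝ) → ℝ} (hf : AEStronglyMeasurable f volume) :
    MemLp f 2 (weightMeasure ψ γ u) ↔ Integrable fun x => f x ^ 2 * psiProd ψ u x := by
  rw [memLp_two_iff_integrable_sq (hf.mono_ac (weightMeasure_ac u)), weightMeasure,
    integrable_withDensity_iff_integrable_smul₀' (aemeasurable_weight hA u)
      (.of_forall fun _ => by simp)]
  have : (fun x => (ENNReal.ofReal (psiProd ψ u x / γ u)).toReal • f x ^ 2) =
      fun x => (γ u)⁻¹ * (f x ^ 2 * psiProd ψ u x) := by
    funext x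
    rw [ENNReal.toReal_ofReal (div_pos (psiProd_pos hA u x) (hγ u)).le, smul_eq_mul]
    ring
  rw [this, integrable_const_mul_iff (isUnit_iff_ne_zero.2 (inv_ne_zero (hγ u).ne'))]

theorem memLp_avg (hA : Admissible ρ ψ) (hγ : ∀ u, 0 < γ u) {f : (Fin d → ℝ) → ℝ}
    (hf : MemAnova ρ ψ f) (u : Finset (Fin d)) : MemLp (avg ρ u f) 2 (weightMeasure ψ γ u) := by
  obtain ⟨h1, -, h3⟩ := hf.weakDeriv_spec u
  exact (memLp_weightMeasure_iff hA hγ u (aestronglyMeasurable_innerInt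
    (fun j => (hA.integrable j).aestronglyMeasurable) u h1.locInt_deriv.aestronglyMeasurable)).2 h3

/-- The map `f ↦ (P_u f)_u` from the ANOVA space to its model. -/
def toModel (hA : Admissible ρ ψ) (hγ : ∀ u, 0 < γ u) :
    anovaSpace ρ ψ hA.integrable hA.weight →ₗ[ℝ] Model ψ γ where
  toFun f := WithLp.toLp 2 fun u => (memLp_avg hA hγ f.2 u).toLp _
  map_add' f g := by
    ext1 u
    simp only [PiLp.add_apply, ← MemLp.toLp_add]
    refine MemLp.toLp_congr _ _ ((weightMeasure_ac u).ae_le ?_)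
    refine (MemAnova.avg_congr (f + g).2 (AEEqFun.coeFn_add f.1 g.1) u).trans ?_
    exact MemAnova.avg_add f.2 g.2 u
  map_smul' c f := by
    ext1 u
    simp only [PiLp.smul_apply, RingHom.id_apply, ← MemLp.toLp_const_smul]
    refine MemLp.toLp_congr _ _ ((weightMeasure_ac u).ae_le ?_)
    refine (MemAnova.avg_congr (c • f).2 (AEEqFun.coeFn_smul c f.1) u).trans ?_
    exact MemAnova.avg_smul f.2 c u

theorem toModel_apply_ae (hA : Admissible ρ ψ) (hγ : ∀ u, 0 < γ u)
    (f : anovaSpace ρ ψ hA.integrable hA.weight) (u : Finset (Fin d)) :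
    toModel hA hγ f u =ᵐ[weightMeasure ψ γ u] avg ρ u f.1 :=
  MemLp.coeFn_toLp (memLp_avg hA hγ f.2 u)

theorem inner_model (hA : Admissible ρ ψ) (hγ : ∀ u, 0 < γ u) (e e' : Model ψ γ) :
    inner ℝ e e' = ∑ u, 1 / γ u * ∫ x, e u x * e' u x * psiProd ψ u x := by
  rw [PiLp.inner_apply]
  refine Finset.sum_congr rfl fun u _ => ?_
  rw [L2.inner_def, ← integral_weightMeasure hA hγ]
  simp [mul_comm]

theorem inner_toModel (hA : Admissible ρ ψ) (hγ : ∀ u, 0 < γ u)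
    (f g : anovaSpace ρ ψ hA.integrable hA.weight) :
    inner ℝ (toModel hA hγ f) (toModel hA hγ g) = anovaInner ρ ψ γ f.1 g.1 := by
  rw [inner_model hA hγ, anovaInner]
  refine Finset.sum_congr rfl fun u _ => ?_
  congr 1
  refine integral_congr_ae ?_
  filter_upwards [(ac_weightMeasure hA hγ u).ae_le (toModel_apply_ae hA hγ f u),
    (ac_weightMeasure hA hγ u).ae_le (toModel_apply_ae hA hγ g u)] with x h1 h2
  rw [h1, h2]
  rfl

theorem toModel_injective (hA : Admissible ρ ψ) (hγ : ∀ u, 0 < γ u) :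
    Function.Injective (toModel hA hγ : _ → Model ψ γ) := by
  rw [injective_iff_map_eq_zero]
  intro f hf
  have h0 : f.1 =ᵐ[volume] 0 := by
    refine ae_eq_zero_of_innerInt_eq_zero (ρ := ρ) hA.integral_eq_one
      (fun u => (MemAnova.weakDeriv_spec f.2 u).1) fun u => ?_
    refine (ac_weightMeasure hA hγ u).ae_le ?_
    refine (toModel_apply_ae hA hγ f u).symm.trans ?_
    rw [hf]
    exact Lp.coeFn_zero _ _ _
  exact Subtype.ext (AEEqFun.ext (h0.trans AEEqFun.coeFn_zero.symm))

/-! ### Reconstruction of a function from its averages -/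

/-- The function with averaged derivatives `P_u f = e_u`. -/
def ofModel (ρ : Fin d → ℝ → ℝ) (e : Model ψ γ) (y : Fin d → ℝ) : ℝ :=
  ∑ u, potential ρ u (e u) ∅ y

theorem measurable_model (e : Model ψ γ) (u : Finset (Fin d)) : Measurable (e u) :=
  (Lp.stronglyMeasurable (e u)).measurable

theorem integrable_sq_model (hA : Admissible ρ ψ) (hγ : ∀ u, 0 < γ u) (e : Model ψ γ)
    (u : Finset (Fin d)) : Integrable fun x => e u x ^ 2 * psiProd ψ u x :=
  (memLp_weightMeasure_iff hA hγ u (measurable_model e u).aestronglyMeasurable).1 (Lp.memLp (e u))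

theorem continuous_ofModel (hA : Admissible ρ ψ) (hγ : ∀ u, 0 < γ u) (e : Model ψ γ) :
    Continuous (ofModel ρ e) :=
  continuous_finsetSum _ fun u _ =>
    continuous_potential hA (measurable_model e u) (integrable_sq_model hA hγ e u)

theorem exists_toModel_eq_single (hA : Admissible ρ ψ) (hγ : ∀ u, 0 < γ u) (e : Model ψ γ)
    (u : Finset (Fin d)) : ∃ f : anovaSpace ρ ψ hA.integrable hA.weight,
      f.1 =ᵐ[volume] potential ρ u (e u) ∅ ∧
        toModel hA hγ f = WithLp.toLp 2 (Pi.single u (e u)) := by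
  have hm := measurable_model e u
  have h2 := integrable_sq_model hA hγ e u
  have hmem := memAnova_potential hA hm h2
  have hmk := AEEqFun.coeFn_mk _ hmem.1.aestronglyMeasurable
  refine ⟨⟨AEEqFun.mk _ hmem.1.aestronglyMeasurable, hmem.congr hmk.symm⟩, hmk, ?_⟩
  ext1 v
  refine Lp.ext ((toModel_apply_ae hA hγ _ v).trans ?_)
  obtain ⟨g, hg, -, h0, h1⟩ := exists_weakDeriv_potential hA hm h2 v
  have h3 := (weightMeasure_ac (ψ := ψ) (γ := γ) v).ae_le (avg_ae_eq (ρ := ρ) (hg.congr hmk.symm))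
  refine Filter.EventuallyEq.trans h3 ?_
  by_cases hvu : v = u
  · subst hvu
    rw [PiLp.toLp_apply, Pi.single_eq_same]
    exact .of_forall fun x => h1 rfl x
  · rw [PiLp.toLp_apply, Pi.single_eq_of_ne hvu]
    exact Filter.EventuallyEq.trans ((weightMeasure_ac v).ae_le (h0 hvu)) (Lp.coeFn_zero _ _ _).symm

theorem exists_toModel_eq (hA : Admissible ρ ψ) (hγ : ∀ u, 0 < γ u) (e : Model ψ γ) :
    ∃ f : anovaSpace ρ ψ hA.integrable hA.weight,
      f.1 =ᵐ[volume] ofModel ρ e ∧ toModel hA hγ f = e := by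
  choose F hF1 hF2 using exists_toModel_eq_single hA hγ e
  refine ⟨∑ u, F u, ?_, ?_⟩
  · have hS : ∀ S : Finset (Finset (Fin d)), ((∑ u ∈ S, F u).1 : (Fin d → ℝ) → ℝ) =ᵐ[volume]
        fun y => ∑ u ∈ S, potential ρ u (e u) ∅ y := by
      intro S
      induction S using Finset.induction_on with
      | empty => exact AEEqFun.coeFn_zero.trans (.of_forall fun y => by simp)
      | insert u S hu ih =>
        rw [Finset.sum_insert hu]
        refine (AEEqFun.coeFn_add (F u).1 (∑ u ∈ S, F u).1).trans ?_
        filter_upwards [hF1 u, ih] with y h1 h2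
        rw [Finset.sum_insert hu, Pi.add_apply, h1, h2]
    exact hS _
  · rw [map_sum]
    ext1 v
    simp only [hF2, WithLp.ofLp_sum, Finset.sum_apply]
    simp

theorem ofModel_toModel_ae (hA : Admissible ρ ψ) (hγ : ∀ u, 0 < γ u)
    (f : anovaSpace ρ ψ hA.integrable hA.weight) :
    f.1 =ᵐ[volume] ofModel ρ (toModel hA hγ f) := by
  obtain ⟨g, hg1, hg2⟩ := exists_toModel_eq hA hγ (toModel hA hγ f)
  rwa [toModel_injective hA hγ hg2] at hg1

/-! ### Representers of point evaluations -/

/-- The component in `u` of the representer of the evaluation at `y`. -/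
def repFun (ρ ψ : Fin d → ℝ → ℝ) (γ : Finset (Fin d) → ℝ) (y : Fin d → ℝ) (u : Finset (Fin d))
    (x : {j // j ∈ u} → ℝ) : ℝ :=
  γ u * ∏ j : {j // j ∈ u}, (stepKer (ρ j) (y j) (x j) / ψ j (x j))

theorem measurable_stepKer_right (hA : Admissible ρ ψ) (j : Fin d) (y : ℝ) :
    Measurable fun t => stepKer (ρ j) y t :=
  (measurable_stepKer (hA.pos j) (hA.integrable j)).comp (measurable_const.prodMk measurable_id)

theorem repFun_mul_repFun_mul (hA : Admissible ρ ψ) (y y' : Fin d → ℝ) (u : Finset (Fin d))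
    (x : {j // j ∈ u} → ℝ) :
    repFun ρ ψ γ y u x * repFun ρ ψ γ y' u x * psiProd ψ u x = γ u ^ 2 *
      ∏ j : {j // j ∈ u}, (stepKer (ρ j) (y j) (x j) * stepKer (ρ j) (y' j) (x j) / ψ j (x j)) := by
  have : ∏ j : {j // j ∈ u}, (stepKer (ρ j) (y j) (x j) * stepKer (ρ j) (y' j) (x j) / ψ j (x j)) =
      (∏ j : {j // j ∈ u}, (stepKer (ρ j) (y j) (x j) / ψ j (x j))) *
      (∏ j : {j // j ∈ u}, (stepKer (ρ j) (y' j) (x j) / ψ j (x j))) * psiProd ψ u x := by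
    rw [psiProd, ← Finset.prod_mul_distrib, ← Finset.prod_mul_distrib]
    refine Finset.prod_congr rfl fun j _ => ?_
    have := (hA.weight_pos j (x j)).ne'
    field_simp
  rw [this, repFun, repFun]
  ring

theorem memLp_repFun (hA : Admissible ρ ψ) (hγ : ∀ u, 0 < γ u) (y : Fin d → ℝ)
    (u : Finset (Fin d)) : MemLp (repFun ρ ψ γ y u) 2 (weightMeasure ψ γ u) := by
  have hm : AEStronglyMeasurable (repFun ρ ψ γ y u) volume := by
    refine AEStronglyMeasurable.const_mul (Finset.aestronglyMeasurable_fun_prod _ fun j _ => ?_) _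
    have h1 : AEMeasurable (fun t => stepKer (ρ j) (y j) t / ψ j t) volume :=
      (measurable_stepKer_right hA j (y j)).aemeasurable.div
        (hA.weight j).aestronglyMeasurable.aemeasurable
    exact h1.aestronglyMeasurable.comp_quasiMeasurePreserving
      (Measure.quasiMeasurePreserving_eval (fun _ : {j // j ∈ u} => (volume : Measure ℝ)) j)
  rw [memLp_weightMeasure_iff hA hγ u hm]
  have h2 : Integrable (fun x : {j // j ∈ u} → ℝ => ∏ j : {j // j ∈ u},
      (stepKer (ρ j) (y j) (x j) * stepKer (ρ j) (y j) (x j) / ψ j (x j))) volume := by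
    refine Integrable.fintype_prod (f := fun (j : {j // j ∈ u}) t =>
      stepKer (ρ j) (y j) t * stepKer (ρ j) (y j) t / ψ j t) fun j => ?_
    refine (integrable_stepBound_sq_div (hA.pos j) (hA.integrable j) (hA.weight_pos j)
      (hA.weight j).aestronglyMeasurable (hA.cond j) |y j|).mono' ?_ (.of_forall fun t => ?_)
    · exact (((measurable_stepKer_right hA j (y j)).mul
        (measurable_stepKer_right hA j (y j))).aemeasurable.div
        (hA.weight j).aestronglyMeasurable.aemeasurable).aestronglyMeasurable
    · rw [norm_div, norm_mul, Real.norm_of_nonneg (hA.weight_pos j t).le, ← sq]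
      refine div_le_div_of_nonneg_right ?_ (hA.weight_pos j t).le
      exact pow_le_pow_left₀ (norm_nonneg _)
        (abs_stepKer_le (hA.pos j) (hA.integrable j) (hA.integral_eq_one j) le_rfl t) 2
  refine (h2.const_mul (γ u ^ 2)).congr (.of_forall fun x => ?_)
  simp only [← repFun_mul_repFun_mul hA]
  ring

/-- The representer of the evaluation at `y`. -/
def rep (hA : Admissible ρ ψ) (hγ : ∀ u, 0 < γ u) (y : Fin d → ℝ) : Model ψ γ :=
  WithLp.toLp 2 fun u => (memLp_repFun hA hγ y u).toLp _

theorem rep_apply_ae (hA : Admissible ρ ψ) (hγ : ∀ u, 0 < γ u) (y : Fin d → ℝ)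
    (u : Finset (Fin d)) : rep hA hγ y u =ᵐ[volume] repFun ρ ψ γ y u :=
  (ac_weightMeasure hA hγ u).ae_le (MemLp.coeFn_toLp (memLp_repFun hA hγ y u))

theorem inner_rep (hA : Admissible ρ ψ) (hγ : ∀ u, 0 < γ u) (y : Fin d → ℝ) (e : Model ψ γ) :
    inner ℝ (rep hA hγ y) e = ofModel ρ e y := by
  rw [inner_model hA hγ, ofModel]
  refine Finset.sum_congr rfl fun u _ => ?_
  rw [potential_empty_eq ρ u (e u) (measurable_model e u) (measurable_stepKer_right hA),
    ← integral_const_mul]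
  refine integral_congr_ae ?_
  filter_upwards [rep_apply_ae hA hγ y u] with x hx
  have : ∏ j : {j // j ∈ u}, stepKer (ρ j) (y j) (x j) =
      (∏ j : {j // j ∈ u}, (stepKer (ρ j) (y j) (x j) / ψ j (x j))) * psiProd ψ u x := by
    rw [psiProd, ← Finset.prod_mul_distrib]
    refine Finset.prod_congr rfl fun j _ => ?_
    rw [div_mul_cancel₀ _ (hA.weight_pos j (x j)).ne']
  rw [hx, this, repFun]
  have := (hγ u).ne'
  field_simp

theorem inner_rep_rep (hA : Admissible ρ ψ) (hγ : ∀ u, 0 < γ u) (x y : Fin d → ℝ) :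
    inner ℝ (rep hA hγ x) (rep hA hγ y) = anovaKernel ρ ψ γ x y := by
  rw [inner_model hA hγ, anovaKernel]
  refine Finset.sum_congr rfl fun u _ => ?_
  have h1 : ∫ z, rep hA hγ x u z * rep hA hγ y u z * psiProd ψ u z =
      ∫ z : {j // j ∈ u} → ℝ, γ u ^ 2 * ∏ j : {j // j ∈ u},
        (stepKer (ρ j) (x j) (z j) * stepKer (ρ j) (y j) (z j) / ψ j (z j)) := by
    refine integral_congr_ae ?_
    filter_upwards [rep_apply_ae hA hγ x u, rep_apply_ae hA hγ y u] with z h1 h2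
    rw [h1, h2, repFun_mul_repFun_mul hA]
  rw [h1, integral_const_mul, integral_fintype_prod_volume_eq_prod (fun (j : {j // j ∈ u}) t =>
    stepKer (ρ j) (x j) t * stepKer (ρ j) (y j) t / ψ j t)]
  have h2 : ∀ j : {j // j ∈ u}, ∫ t, stepKer (ρ j) (x j) t * stepKer (ρ j) (y j) t / ψ j t =
      eta (ρ j) (ψ j) (x j) (y j) := fun j =>
    integral_stepKer_mul_stepKer (hA.pos j) (hA.integrable j) (hA.integral_eq_one j)
      (hA.weight_pos j) (hA.weight j).aestronglyMeasurable (hA.cond j) _ _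
  simp_rw [h2]
  rw [Finset.prod_coe_sort u fun j => eta (ρ j) (ψ j) (x j) (y j)]
  have := (hγ u).ne'
  field_simp

/-! ### The reproducing kernel Hilbert space -/

/-- A vector space whose inner product is pulled back from a Hilbert space along a linear
bijection `T` is a reproducing kernel Hilbert space for the evaluations
`f ↦ ⟪k x, T f⟫`, if these separate points. -/
theorem exists_rkhs_of_core {V E X : Type*} [AddCommGroup V] [Module ℝ V]
    [NormedAddCommGroup E] [InnerProductSpace ℝ E] [CompleteSpace E]
    (T : V →ₗ[ℝ] E) (hT : Function.Surjective T) (core : InnerProductSpace.Core ℝ V)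
    (hcore : ∀ f g, core.inner f g = inner ℝ (T f) (T g)) (k : X → E)
    (hk : ∀ e, (∀ x, inner ℝ (k x) e = 0) → e = 0) :
    letI : NormedAddCommGroup V := core.toNormedAddCommGroup
    letI : InnerProductSpace ℝ V := InnerProductSpace.ofCore core.toCore
    ∃ (_ : CompleteSpace V) (R : RKHS ℝ V X ℝ),
      (∀ f x, R.coeCLM f x = inner ℝ (k x) (T f)) ∧
      ∀ x y, RKHS.kernel V x y 1 = inner ℝ (k x) (k y) := by
  let : NormedAddCommGroup V := core.toNormedAddCommGroup
  let : InnerProductSpace ℝ V := InnerProductSpace.ofCore core.toCore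
  have hin : ∀ f g : V, inner ℝ f g = inner ℝ (T f) (T g) := hcore
  have hnorm : ∀ f : V, ‖T f‖ = ‖f‖ := fun f => by
    rw [norm_eq_sqrt_real_inner, norm_eq_sqrt_real_inner, hin]
  let Ti : V →ₗᵢ[ℝ] E := ⟨T, hnorm⟩
  have hcomp : CompleteSpace V :=
    (Ti.isometry.isUniformInducing.completeSpace_congr hT).2 inferInstance
  let L : V →L[ℝ] X → ℝ :=
    ContinuousLinearMap.pi fun x => (innerSL ℝ (k x)).comp Ti.toContinuousLinearMap
  have hL : ∀ f x, L f x = inner ℝ (k x) (T f) := fun f x => rfl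
  have hinj : Function.Injective (L : V → X → ℝ) := by
    rw [injective_iff_map_eq_zero]
    intro f hf
    have h1 : T f = 0 := hk _ fun x => by rw [← hL, hf]; rfl
    rw [← norm_eq_zero, ← hnorm, h1, norm_zero]
  let R : RKHS ℝ V X ℝ := ⟨L, hinj⟩
  refine ⟨hcomp, R, hL, fun x y => ?_⟩
  obtain ⟨g, hg⟩ := hT (k y)
  have h1 : RKHS.kerFun V y 1 = g := by
    refine ext_inner_right ℝ fun f => ?_
    rw [RKHS.kerFun_inner, hin, hg]
    have : inner ℝ (1 : ℝ) (f y) = f y := by simp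
    rw [this]
    exact hL f y
  rw [← RKHS.kerFun_apply, h1, ← hg]
  exact hL g x

/-- The inner product on the ANOVA space. -/
@[reducible]
def anovaCore (hA : Admissible ρ ψ) (hγ : ∀ u, 0 < γ u) :
    InnerProductSpace.Core ℝ (anovaSpace ρ ψ hA.integrable hA.weight) where
  inner f g := anovaInner ρ ψ γ f.1 g.1
  conj_inner_symm f g := by
    simp only [← inner_toModel hA hγ]
    exact inner_conj_symm _ _
  re_inner_nonneg f := by
    simp only [← inner_toModel hA hγ]
    exact inner_self_nonneg
  add_left f g k := by
    simp only [← inner_toModel hA hγ, map_add]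
    exact inner_add_left _ _ _
  smul_left f g c := by
    simp only [← inner_toModel hA hγ, map_smul]
    exact inner_smul_left _ _ _
  definite f hf := by
    simp only [← inner_toModel hA hγ] at hf
    exact toModel_injective hA hγ ((inner_self_eq_zero.1 hf).trans (map_zero _).symm)

end Anova

end

theorem mainTheorem3 (d : ℕ) (hd : 1 ≤ d) (ρ ψ : Fin d → ℝ → ℝ) (γ : Finset (Fin d) → ℝ)
    (hρ_pos : ∀ j t, 0 < ρ j t)
    (hρ : ∀ j, Integrable (ρ j) volume)
    (hρ_one : ∀ j, ∫ t, ρ j t = 1)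
    (hψ_pos : ∀ j t, 0 < ψ j t)
    (hψ : ∀ j, LocallyIntegrable (ψ j) volume)
    (hψ_inv : ∀ j, LocallyIntegrable (fun t => 1 / ψ j t) volume)
    (hγ : ∀ u, 0 < γ u)
    (hweak : ∀ j, Anova.WeakerCondition (ρ j) (ψ j)) :
    ∃ core : InnerProductSpace.Core ℝ (Anova.anovaSpace ρ ψ hρ hψ),
      (∀ f g : Anova.anovaSpace ρ ψ hρ hψ,
        core.inner f g = Anova.anovaInner ρ ψ γ f.1 g.1) ∧
      letI : NormedAddCommGroup (Anova.anovaSpace ρ ψ hρ hψ) := core.toNormedAddCommGroup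
      letI : InnerProductSpace ℝ (Anova.anovaSpace ρ ψ hρ hψ) :=
        InnerProductSpace.ofCore core.toCore
      ∃ (_ : CompleteSpace (Anova.anovaSpace ρ ψ hρ hψ))
        (R : RKHS ℝ (Anova.anovaSpace ρ ψ hρ hψ) (Fin d → ℝ) ℝ),
        -- the function attached to a class is its continuous representative
        (∀ f : Anova.anovaSpace ρ ψ hρ hψ,
          Continuous (R.coeCLM f) ∧ R.coeCLM f =ᵐ[volume] f.1) ∧
        (∀ x y, RKHS.kernel (Anova.anovaSpace ρ ψ hρ hψ) x y 1 = Anova.anovaKernel ρ ψ γ x y) ∧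
        (∀ y, Anova.MemAnova ρ ψ (fun x => Anova.anovaKernel ρ ψ γ x y)) ∧
        (∀ (f : Anova.anovaSpace ρ ψ hρ hψ) (y : Fin d → ℝ),
          R.coeCLM f y =
            Anova.anovaInner ρ ψ γ f.1 (fun x => Anova.anovaKernel ρ ψ γ x y)) := by
  have hA : Anova.Admissible ρ ψ := ⟨hρ_pos, hρ, hρ_one, hψ_pos, hψ, hψ_inv, hweak⟩
  have hsurj : Function.Surjective (Anova.toModel hA hγ) := fun e =>
    let ⟨f, _, hf⟩ := Anova.exists_toModel_eq hA hγ e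
    ⟨f, hf⟩
  have hsep : ∀ e : Anova.Model ψ γ, (∀ y, inner ℝ (Anova.rep hA hγ y) e = 0) → e = 0 := by
    intro e he
    obtain ⟨f, hf1, rfl⟩ := Anova.exists_toModel_eq hA hγ e
    have h0 : Anova.ofModel ρ (Anova.toModel hA hγ f) = 0 :=
      funext fun y => (Anova.inner_rep hA hγ y _).symm.trans (he y)
    have hf0 : f = 0 := by
      refine Subtype.ext (AEEqFun.ext (hf1.trans ?_))
      rw [h0]
      exact AEEqFun.coeFn_zero.symm
    rw [hf0, map_zero]
  -- the kernel function at `y` corresponds to the representer of the evaluation at `y`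
  have hker : ∀ y, ∃ g : Anova.anovaSpace ρ ψ hρ hψ,
      g.1 =ᵐ[volume] (fun x => Anova.anovaKernel ρ ψ γ x y) ∧
        Anova.toModel hA hγ g = Anova.rep hA hγ y := fun y => by
    obtain ⟨g, hg1, hg2⟩ := Anova.exists_toModel_eq hA hγ (Anova.rep hA hγ y)
    refine ⟨g, hg1.trans (.of_forall fun x => ?_), hg2⟩
    rw [← Anova.inner_rep hA hγ, Anova.inner_rep_rep]
  obtain ⟨hcomp, R, hR, hK⟩ := Anova.exists_rkhs_of_core (Anova.toModel hA hγ) hsurj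
    (Anova.anovaCore hA hγ) (fun f g => (Anova.inner_toModel hA hγ f g).symm) (Anova.rep hA hγ) hsep
  refine ⟨Anova.anovaCore hA hγ, fun f g => rfl, hcomp, R, fun f => ?_, fun x y => ?_, fun y => ?_,
    fun f y => ?_⟩
  · have hfun : R.coeCLM f = Anova.ofModel ρ (Anova.toModel hA hγ f) :=
      funext fun y => (hR f y).trans (Anova.inner_rep hA hγ y _)
    rw [hfun]
    exact ⟨Anova.continuous_ofModel hA hγ _, (Anova.ofModel_toModel_ae hA hγ f).symm⟩
  · exact (hK x y).trans (Anova.inner_rep_rep hA hγ x y)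
  · obtain ⟨g, hg1, -⟩ := hker y
    exact Anova.MemAnova.congr g.2 hg1
  · obtain ⟨g, hg1, hg2⟩ := hker y
    rw [hR f y, ← hg2, real_inner_comm, Anova.inner_toModel hA hγ]
    exact Anova.anovaInner_congr f.2 g.2 (ae_eq_refl _) hg1
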